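/- Let $k$ be an infinite field and let $SL_2(k)$ be regarded as a discrete group. A \emph{normalized character} on a group $\Gamma$ is a function $\varphi\colon\Gamma\to\mathbb C$ with $\varphi(e)=1$ that is conjugation invariant, i.e. $\varphi(hgh^{-1})=\varphi(g)$ for all $g,h\in\Gamma$, and positive definite, i.e. $\sum_{i,j=1}^n\lambda_i\bar\lambda_j\,\varphi(g_j^{-1}g_i)\ge 0$ for all $n$, all $\lambda_1,\dots,\lambda_n\in\mathbb C$ and all $g_1,\dots,g_n\in\Gamma$. It is \emph{extremal} if it is an extreme point of the convex set of normalized characters on $\Gamma$. Then every extremal character $\tau$ on $SL_2(k)$ other than the constant character $\tau\equiv 1$ is induced from the centre $C=\{\pm1\}$ of $SL_2(k)$, i.e. $\{g\in SL_2(k)\mid \tau(g)\neq 0\}\subset C$. -/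

import Mathlib

open scoped ComplexOrder MatrixGroups

/-- A function `φ` on a (discrete) group is positive definite if all the sums
`∑ i j, λ i * conj (λ j) * φ ((g j)⁻¹ * g i)` are real and non-negative
(`0 ≤ z` for complex `z` means `0 ≤ z.re` and `z.im = 0`). -/
def IsPositiveDefinite {Γ : Type*} [Group Γ] (φ : Γ → ℂ) : Prop :=
  ∀ (n : ℕ) (c : Fin n → ℂ) (g : Fin n → Γ),
    0 ≤ ∑ i, ∑ j, c i * star (c j) * φ ((g j)⁻¹ * g i)

/-- A class function: `φ (h g h⁻¹) = φ g`. -/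
def IsConjInvariant {Γ : Type*} [Group Γ] (φ : Γ → ℂ) : Prop :=
  ∀ g h : Γ, φ (h * g * h⁻¹) = φ g

/-- A character: a positive definite, conjugation invariant function. -/
def IsGroupCharacter {Γ : Type*} [Group Γ] (φ : Γ → ℂ) : Prop :=
  IsPositiveDefinite φ ∧ IsConjInvariant φ

/-- The convex set of normalized characters, `φ 1 = 1`. -/
def normalizedCharacters (Γ : Type*) [Group Γ] : Set (Γ → ℂ) :=
  {φ | IsGroupCharacter φ ∧ φ 1 = 1}

/-- An extremal character: an extreme point of the convex set of normalized characters. -/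
def IsExtremalCharacter {Γ : Type*} [Group Γ] (φ : Γ → ℂ) : Prop :=
  φ ∈ Set.extremePoints ℝ (normalizedCharacters Γ)

/-- `φ` is induced from the normal subgroup `Λ` if it vanishes off `Λ`. -/
def IsInducedFrom {Γ : Type*} [Group Γ] (φ : Γ → ℂ) (Λ : Subgroup Γ) [Λ.Normal] : Prop :=
  {g : Γ | φ g ≠ 0} ⊆ (Λ : Set Γ)

/-- The centre of `SL₂(k)` is `{1, -1}`. -/
theorem mem_center_SL2_iff {k : Type*} [Field k] (g : SL(2, k)) :
    g ∈ Subgroup.center SL(2, k) ↔ g = 1 ∨ g = -1 := by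
  rw [Matrix.SpecialLinearGroup.mem_center_iff]
  constructor
  · rintro ⟨r, hr, h⟩
    simp only [Fintype.card_fin] at hr
    rcases (by simpa using hr : r = 1 ∨ r = -1) with rfl | rfl
    · left; ext i j; rw [← h]; simp
    · right; ext i j; rw [← h]; fin_cases i <;> fin_cases j <;> simp
  · rintro (rfl | rfl)
    · exact ⟨1, by simp, by simp⟩
    · refine ⟨-1, by simp, ?_⟩
      ext i j; fin_cases i <;> fin_cases j <;> simp

/-! Let `ξ = π.vec 1` in the GNS space of `τ`, let `x ≠ 0`, and let `P` be the projection onto the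
vectors fixed by all `upper (c ^ 2 * x)`. Conjugation by diagonal matrices makes `τ` constant on
these elements for `c ≠ 0`, and invariant means along squares yield `P`
(`IsInvariantMean.mean_inner_sq`), so `τ (upper x) = ‖P ξ‖ ^ 2 = t`. The heart is `t = 0` or `t = 1`
(`SL2.norm_proj_sq_eq_zero_or_one`). If `t = 1` for some `x`, then `{τ = 1}` is a normal subgroup
with a nontrivial unipotent, hence everything. If `t = 0` for all `x`, each noncentral element has
infinitely many conjugates with quotients on which `τ` vanishes, and Cauchy–Schwarz kills `τ` there.

Suppose `0 < t < 1` and put `w = weyl x⁻¹`. By the Bruhat decomposition the conjugation translates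
of `P ξ` attached to distinct cosets of the triangular group have one common inner product, so their
mean along `upper (c ^ 2 * x) * w` is conjugation invariant. It defines a character dominated by
`τ`; extremality forces it to be `t * τ`, and the mean of the corresponding conjugates of `P` is the
scalar `t` (`SL2.mean_conjProj`). Compressing gives `P w P w⁻¹ P = t P`. The relation
`SL2.weyl_conj_upper_sq` turns the left side into a mean of `P w⁻¹ (diag c) ^ 2 P`; as `w⁻¹` inverts
diagonal matrices, their squares act trivially on the range of `P`. Hence `P w⁻¹ P = t P`, so `t ^ 2
= t`, a contradiction. -/

open Filter Topology

/-! ### Invariant means on abelian groups -/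

/-- A function bounded in norm. -/
def IsBoundedFun {G : Type*} (f : G → ℂ) : Prop := ∃ C : ℝ, ∀ x, ‖f x‖ ≤ C

section BoundedFun

variable {G : Type*} {f g : G → ℂ}

theorem IsBoundedFun.const (c : ℂ) : IsBoundedFun (fun _ : G => c) := ⟨‖c‖, fun _ => le_rfl⟩

theorem IsBoundedFun.add (hf : IsBoundedFun f) (hg : IsBoundedFun g) :
    IsBoundedFun (fun x => f x + g x) := by
  obtain ⟨C, hC⟩ := hf
  obtain ⟨D, hD⟩ := hg
  exact ⟨C + D, fun x => (norm_add_le _ _).trans (add_le_add (hC x) (hD x))⟩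

theorem IsBoundedFun.mul (hf : IsBoundedFun f) (hg : IsBoundedFun g) :
    IsBoundedFun (fun x => f x * g x) := by
  obtain ⟨C, hC⟩ := hf
  obtain ⟨D, hD⟩ := hg
  refine ⟨C * D, fun x => ?_⟩
  rw [norm_mul]
  exact mul_le_mul (hC x) (hD x) (norm_nonneg _) ((norm_nonneg _).trans (hC x))

theorem IsBoundedFun.const_mul (c : ℂ) (hf : IsBoundedFun f) : IsBoundedFun (fun x => c * f x) :=
  (IsBoundedFun.const c).mul hf

theorem IsBoundedFun.star (hf : IsBoundedFun f) : IsBoundedFun (fun x => star (f x)) := by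
  obtain ⟨C, hC⟩ := hf
  exact ⟨C, fun x => by rw [norm_star]; exact hC x⟩

theorem IsBoundedFun.comp {G' : Type*} (hf : IsBoundedFun f) (φ : G' → G) :
    IsBoundedFun (fun x => f (φ x)) := by
  obtain ⟨C, hC⟩ := hf
  exact ⟨C, fun x => hC _⟩

theorem IsBoundedFun.sum {ι : Type*} (s : Finset ι) {F : ι → G → ℂ}
    (h : ∀ i ∈ s, IsBoundedFun (F i)) : IsBoundedFun (fun x => ∑ i ∈ s, F i x) := by
  classical
  induction s using Finset.induction_on with
  | empty => simpa using IsBoundedFun.const (0 : ℂ)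
  | insert a s ha ih =>
    simp only [Finset.sum_insert ha]
    exact (h a (by simp)).add (ih fun i hi => h i (by simp [hi]))

theorem isBoundedFun_inner {H : Type*} [NormedAddCommGroup H] [InnerProductSpace ℂ H]
    {F F' : G → H} {C D : ℝ} (hF : ∀ x, ‖F x‖ ≤ C)
    (hF' : ∀ x, ‖F' x‖ ≤ D) : IsBoundedFun (fun x => inner ℂ (F x) (F' x)) :=
  ⟨C * D, fun x => (norm_inner_le_norm _ _).trans
    (mul_le_mul (hF x) (hF' x) (norm_nonneg _) ((norm_nonneg _).trans (hF x)))⟩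

end BoundedFun

/-- A translation invariant mean on the bounded functions of an additive group. -/
structure IsInvariantMean {G : Type*} [AddCommGroup G] (m : (G → ℂ) → ℂ) : Prop where
  add : ∀ {f g}, IsBoundedFun f → IsBoundedFun g → m (fun x => f x + g x) = m f + m g
  const_mul : ∀ {f} (c : ℂ), IsBoundedFun f → m (fun x => c * f x) = c * m f
  one : m (fun _ => 1) = 1
  map_star : ∀ {f}, IsBoundedFun f → m (fun x => star (f x)) = star (m f)
  norm_le : ∀ {f} {C : ℝ}, (∀ x, ‖f x‖ ≤ C) → ‖m f‖ ≤ C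
  nonneg : ∀ {f}, IsBoundedFun f → (∀ x, 0 ≤ f x) → 0 ≤ m f
  translate : ∀ {f} (a : G), IsBoundedFun f → m (fun x => f (x + a)) = m f

section Construction

variable {G : Type*} [AddCommGroup G]

/-- Iterated Cesàro averages at `0`, of length `n` along each entry of the list. -/
noncomputable def cesaroAverage (n : ℕ) : List G → (G → ℂ) → ℂ
  | [], f => f 0
  | e :: l, f => cesaroAverage n l fun x => (n : ℂ)⁻¹ * ∑ j ∈ Finset.range n, f (x + j • e)

theorem cesaroAverage_add (n : ℕ) (l : List G) (f g : G → ℂ) :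
    cesaroAverage n l (fun x => f x + g x) = cesaroAverage n l f + cesaroAverage n l g := by
  induction l generalizing f g with
  | nil => rfl
  | cons e l ih => simp only [cesaroAverage, ← ih, ← mul_add, Finset.sum_add_distrib]

theorem cesaroAverage_const_mul (n : ℕ) (l : List G) (c : ℂ) (f : G → ℂ) :
    cesaroAverage n l (fun x => c * f x) = c * cesaroAverage n l f := by
  induction l generalizing f with
  | nil => rfl
  | cons e l ih => simp only [cesaroAverage, ← ih, ← Finset.mul_sum, mul_left_comm]

theorem cesaroAverage_star (n : ℕ) (l : List G) (f : G → ℂ) :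
    cesaroAverage n l (fun x => star (f x)) = star (cesaroAverage n l f) := by
  induction l generalizing f with
  | nil => rfl
  | cons e l ih =>
    simp only [cesaroAverage, ← ih, star_mul', star_sum, star_inv₀, star_natCast]

theorem cesaroAverage_one {n : ℕ} (hn : 0 < n) (l : List G) :
    cesaroAverage n l (fun _ => 1) = 1 := by
  induction l with
  | nil => rfl
  | cons e l ih =>
    have : (n : ℂ) ≠ 0 := by exact_mod_cast hn.ne'
    simpa [cesaroAverage, this] using ih

theorem norm_cesaroAverage_le {n : ℕ} (hn : 0 < n) (l : List G) {f : G → ℂ} {C : ℝ}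
    (hf : ∀ x, ‖f x‖ ≤ C) : ‖cesaroAverage n l f‖ ≤ C := by
  induction l generalizing f with
  | nil => exact hf 0
  | cons e l ih =>
    refine ih fun x => ?_
    have h1 : ‖∑ j ∈ Finset.range n, f (x + j • e)‖ ≤ n * C := by
      refine (norm_sum_le_of_le _ fun j _ => hf _).trans ?_
      simp
    have h2 : (0 : ℝ) < n := by exact_mod_cast hn
    rw [norm_mul, norm_inv, Complex.norm_natCast, inv_mul_le_iff₀ h2]
    exact h1

theorem cesaroAverage_nonneg (n : ℕ) (l : List G) {f : G → ℂ} (hf : ∀ x, 0 ≤ f x) :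
    0 ≤ cesaroAverage n l f := by
  induction l generalizing f with
  | nil => exact hf 0
  | cons e l ih =>
    refine ih fun x => mul_nonneg ?_ (Finset.sum_nonneg fun j _ => hf _)
    exact inv_nonneg.2 (Nat.cast_nonneg n)

/-- Averaging in the direction `a` telescopes, leaving boundary terms of norm at most `2 * C / n`;
averages in other directions commute with translation and do not increase bounds. -/
theorem norm_cesaroAverage_translate_sub_le {n : ℕ} (hn : 0 < n) (l : List G) {a : G}
    (ha : a ∈ l) {f : G → ℂ} {C : ℝ} (hf : ∀ x, ‖f x‖ ≤ C) :
    ‖cesaroAverage n l (fun x => f (x + a)) - cesaroAverage n l f‖ ≤ 2 * C / n := by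
  have h2 : (0 : ℝ) < n := by exact_mod_cast hn
  induction l generalizing f with
  | nil => simp at ha
  | cons e l ih =>
    by_cases hae : a = e
    · subst hae
      have key : cesaroAverage n (a :: l) (fun x => f (x + a)) - cesaroAverage n (a :: l) f
          = cesaroAverage n l fun x => (n : ℂ)⁻¹ * (f (x + n • a) - f x) := by
        rw [sub_eq_iff_eq_add]
        simp only [cesaroAverage]
        rw [← cesaroAverage_add]
        congr 1
        ext x
        rw [← mul_add]
        congr 1
        have h := Finset.sum_range_succ (fun j => f (x + j • a)) n
        rw [Finset.sum_range_succ'] at h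
        simp only [zero_smul, add_zero, succ_nsmul, ← add_assoc] at h
        simp only [add_comm] at h ⊢
        linear_combination h
      rw [key]
      refine norm_cesaroAverage_le hn l fun x => ?_
      rw [norm_mul, norm_inv, Complex.norm_natCast, inv_mul_eq_div]
      gcongr
      refine (norm_sub_le _ _).trans ?_
      linarith [hf (x + n • a), hf x]
    · have hal : a ∈ l := by simpa [hae] using ha
      have := ih hal (f := fun x => (n : ℂ)⁻¹ * ∑ j ∈ Finset.range n, f (x + j • e)) (by
        intro x
        have := norm_cesaroAverage_le hn [e] (f := fun y => f (x + y)) (fun y => hf _)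
        simpa [cesaroAverage] using this)
      simp only [cesaroAverage]
      simpa only [add_right_comm] using this

/-- Every abelian group is amenable. -/
theorem exists_invariantMean (G : Type*) [AddCommGroup G] :
    ∃ m : (G → ℂ) → ℂ, IsInvariantMean m := by
  classical
  -- Along `ω` the set of directions eventually contains any given element and the length exceeds
  -- any bound.
  let ω : Ultrafilter (Finset G × ℕ) := Ultrafilter.of atTop
  have hω : (ω : Filter (Finset G × ℕ)) ≤ atTop := Ultrafilter.of_le _
  let A : Finset G × ℕ → (G → ℂ) → ℂ := fun i f => cesaroAverage i.2 i.1.toList f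
  have hpos : ∀ᶠ i : Finset G × ℕ in ω, 0 < i.2 :=
    hω (by
      filter_upwards [eventually_ge_atTop ((∅ : Finset G), 1)] with i hi
      exact hi.2)
  have hlim : ∀ f : G → ℂ, IsBoundedFun f → ∃ z, Tendsto (fun i => A i f) ω (𝓝 z) := by
    rintro f ⟨C, hC⟩
    obtain ⟨z, -, hz⟩ := (isCompact_closedBall (0 : ℂ) C).ultrafilter_le_nhds
      (ω.map fun i => A i f) (by
        simp only [Ultrafilter.coe_map, le_principal_iff, mem_map]
        filter_upwards [hpos] with i hi
        simpa using norm_cesaroAverage_le hi _ hC)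
    exact ⟨z, hz⟩
  let m : (G → ℂ) → ℂ := fun f => limUnder (ω : Filter _) fun i => A i f
  have hm : ∀ f : G → ℂ, IsBoundedFun f → Tendsto (fun i => A i f) ω (𝓝 (m f)) :=
    fun f hf => tendsto_nhds_limUnder (hlim f hf)
  refine ⟨m, ?_, ?_, ?_, ?_, ?_, ?_, ?_⟩
  · intro f g hf hg
    refine tendsto_nhds_unique (hm _ (hf.add hg)) ?_
    simpa only [A, cesaroAverage_add] using (hm f hf).add (hm g hg)
  · intro f c hf
    refine tendsto_nhds_unique (hm _ (hf.const_mul c)) ?_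
    simpa only [A, cesaroAverage_const_mul] using (hm f hf).const_mul c
  · refine tendsto_nhds_unique (hm _ (IsBoundedFun.const 1)) ?_
    refine Tendsto.congr' ?_ tendsto_const_nhds
    filter_upwards [hpos] with i hi
    exact (cesaroAverage_one hi _).symm
  · intro f hf
    refine tendsto_nhds_unique (hm _ hf.star) ?_
    simpa only [A, cesaroAverage_star] using (hm f hf).star
  · intro f C hC
    refine le_of_tendsto (hm f ⟨C, hC⟩).norm ?_
    filter_upwards [hpos] with i hi
    exact norm_cesaroAverage_le hi _ hC
  · intro f hf h0
    exact ge_of_tendsto (hm f hf) (Eventually.of_forall fun i => cesaroAverage_nonneg _ _ h0)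
  · rintro f a ⟨C, hC⟩
    have h1 := (hm _ (IsBoundedFun.comp ⟨C, hC⟩ (fun x => x + a))).sub (hm f ⟨C, hC⟩)
    have h2 : Tendsto (fun i => A i (fun x => f (x + a)) - A i f) ω (𝓝 0) := by
      have h3 : Tendsto (fun i : Finset G × ℕ => 2 * C / (i.2 : ℝ)) ω (𝓝 0) := by
        refine Tendsto.mono_left ?_ hω
        rw [← prod_atTop_atTop_eq]
        exact (tendsto_const_div_atTop_nhds_zero_nat (2 * C)).comp tendsto_snd
      refine squeeze_zero_norm' ?_ h3
      filter_upwards [hpos, hω (eventually_ge_atTop (({a} : Finset G), 0))] with i hi hia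
      refine norm_cesaroAverage_translate_sub_le hi _ ?_ hC
      simpa using hia.1
    exact sub_eq_zero.1 (tendsto_nhds_unique h1 h2)

end Construction

namespace IsInvariantMean

variable {G : Type*} [AddCommGroup G] {m : (G → ℂ) → ℂ} {f g : G → ℂ}

theorem const (hm : IsInvariantMean m) (c : ℂ) : m (fun _ => c) = c := by
  simpa [hm.one] using hm.const_mul c (IsBoundedFun.const (1 : ℂ))

theorem sub (hm : IsInvariantMean m) (hf : IsBoundedFun f) (hg : IsBoundedFun g) :
    m (fun x => f x - g x) = m f - m g := by
  have h := hm.add hf (hg.const_mul (-1))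
  rw [hm.const_mul _ hg] at h
  simpa [sub_eq_add_neg] using h

theorem sum (hm : IsInvariantMean m) {ι : Type*} (s : Finset ι) {F : ι → G → ℂ}
    (h : ∀ i ∈ s, IsBoundedFun (F i)) :
    m (fun x => ∑ i ∈ s, F i x) = ∑ i ∈ s, m (F i) := by
  classical
  induction s using Finset.induction_on with
  | empty => simpa using hm.const 0
  | insert a s ha ih =>
    simp only [Finset.sum_insert ha]
    rw [hm.add (h a (by simp)) (IsBoundedFun.sum s fun i hi => h i (by simp [hi])),
      ih fun i hi => h i (by simp [hi])]

theorem mono (hm : IsInvariantMean m) (hf : IsBoundedFun f) (hg : IsBoundedFun g)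
    (hfg : ∀ x, f x ≤ g x) : m f ≤ m g := by
  have h := hm.nonneg (f := fun x => g x + (-1) * f x) (hg.add (hf.const_mul _))
    fun x => by simpa [← sub_eq_add_neg] using hfg x
  rw [hm.add hg (hf.const_mul _), hm.const_mul _ hf] at h
  simpa [← sub_eq_add_neg] using h

/-- By translation all point masses have the same mean, and any `N` of them have total mean at most
`1`. -/
theorem eq_zero_of_finite_support (hm : IsInvariantMean m) [Infinite G]
    (hf : (Function.support f).Finite) : m f = 0 := by
  classical
  let χ : G → G → ℂ := fun a x => if x = a then 1 else 0
  have hb : ∀ a, IsBoundedFun (χ a) := fun a => ⟨1, fun x => by simp only [χ]; split_ifs <;> simp⟩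
  have htr : ∀ a, m (χ a) = m (χ 0) := by
    intro a
    rw [← hm.translate a (hb a)]
    simp [χ]
  have h0 : 0 ≤ m (χ 0) := hm.nonneg (hb 0) fun x => by simp only [χ]; split_ifs <;> simp
  have hχ : m (χ 0) = 0 := by
    by_contra hne
    have hlt : 0 < ‖m (χ 0)‖ := norm_pos_iff.2 hne
    obtain ⟨N, hN⟩ := exists_nat_gt (1 / ‖m (χ 0)‖)
    obtain ⟨s, hs⟩ := Infinite.exists_subset_card_eq G N
    have h1 : ‖m (fun x => ∑ a ∈ s, χ a x)‖ ≤ 1 := hm.norm_le fun x => by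
      simp only [χ, Finset.sum_ite_eq]
      split_ifs <;> simp
    rw [hm.sum s fun a _ => hb a, Finset.sum_congr rfl fun a _ => htr a, Finset.sum_const, hs,
      nsmul_eq_mul, norm_mul, Complex.norm_natCast] at h1
    rw [div_lt_iff₀ hlt] at hN
    linarith
  have hrep : f = fun x => ∑ a ∈ hf.toFinset, f a * χ a x := by
    ext x
    simp only [χ, mul_ite, mul_one, mul_zero, Finset.sum_ite_eq]
    split_ifs with h
    · rfl
    · simpa using h
  rw [hrep, hm.sum _ fun a _ => (hb a).const_mul _]
  refine Finset.sum_eq_zero fun a _ => ?_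
  rw [hm.const_mul _ (hb a), htr, hχ, mul_zero]

theorem congr_off_finite (hm : IsInvariantMean m) [Infinite G]
    (hf : IsBoundedFun f) (hg : IsBoundedFun g)
    (h : {x | f x ≠ g x}.Finite) : m f = m g := by
  rw [← sub_eq_zero, ← hm.sub hf hg]
  refine hm.eq_zero_of_finite_support (h.subset fun x hx => ?_)
  simpa [sub_eq_zero] using hx

/-- The Cauchy–Schwarz inequality for a mean. -/
theorem norm_sq_le (hm : IsInvariantMean m) (hf : IsBoundedFun f) :
    (‖m f‖ ^ 2 : ℝ) ≤ m (fun x => ((‖f x‖ ^ 2 : ℝ) : ℂ)) := by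
  have hsq : ∀ z : ℂ, ((‖z‖ ^ 2 : ℝ) : ℂ) = z * star z := fun z => by
    simpa using (Complex.mul_conj' z).symm
  -- The variance `|f - z| ^ 2` has nonnegative mean, which equals the mean of `|f| ^ 2` minus `|z|
  -- ^ 2`.
  set z := m f with hz
  have h := hm.nonneg (f := fun x => (f x * star (f x) + (-star z) * f x) + ((-z) * star (f x)
      + z * star z)) (((hf.mul hf.star).add (hf.const_mul _)).add
      ((hf.star.const_mul _).add (IsBoundedFun.const _))) fun x => by
    have : f x * star (f x) + (-star z) * f x + ((-z) * star (f x) + z * star z)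
        = ((‖f x - z‖ ^ 2 : ℝ) : ℂ) := by
      rw [hsq, star_sub]; ring
    rw [this]
    exact Complex.zero_le_real.2 (sq_nonneg _)
  rw [hm.add ((hf.mul hf.star).add (hf.const_mul _))
      ((hf.star.const_mul _).add (IsBoundedFun.const _)),
    hm.add (hf.mul hf.star) (hf.const_mul _), hm.add (hf.star.const_mul _) (IsBoundedFun.const _),
    hm.const_mul _ hf, hm.const_mul _ hf.star, hm.map_star hf, hm.const, ← hz] at h
  simp only [hsq]
  have h' : 0 ≤ m (fun x => f x * star (f x)) - z * star z := by
    convert h using 1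
    ring
  exact sub_nonneg.1 h'

variable {H : Type*} [NormedAddCommGroup H] [InnerProductSpace ℂ H]

/-- The mean of a bounded function with values in a Hilbert space. -/
theorem exists_vectorMean (hm : IsInvariantMean m) [CompleteSpace H] {F : G → H} {C : ℝ}
    (hF : ∀ x, ‖F x‖ ≤ C) : ∃ y : H, ∀ w, inner ℂ y w = m (fun x => inner ℂ (F x) w) := by
  have hb : ∀ w : H, IsBoundedFun (fun x => inner ℂ (F x) w) := fun w =>
    isBoundedFun_inner hF fun _ => le_refl ‖w‖
  let ℓ : H →ₗ[ℂ] ℂ :=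
    { toFun := fun w => m (fun x => inner ℂ (F x) w)
      map_add' := fun w w' => by
        simp only [inner_add_right]
        exact hm.add (hb w) (hb w')
      map_smul' := fun c w => by
        simp only [inner_smul_right]
        exact hm.const_mul c (hb w) }
  let ℓ' : H →L[ℂ] ℂ := ℓ.mkContinuous C fun w => hm.norm_le fun x =>
    (norm_inner_le_norm _ _).trans (mul_le_mul_of_nonneg_right (hF x) (norm_nonneg _))
  refine ⟨(InnerProductSpace.toDual ℂ H).symm ℓ', fun w => ?_⟩
  rw [InnerProductSpace.toDual_symm_apply]
  rfl

end IsInvariantMean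

/-! ### Mean ergodic theorems for unitary representations -/

section SquareAverages

variable {H : Type*} [NormedAddCommGroup H] [InnerProductSpace ℂ H]

theorem inner_isometryEquiv_apply (T : H ≃ₗᵢ[ℂ] H) (x y : H) :
    inner ℂ x (T y) = inner ℂ (T⁻¹ x) y := by
  rw [← T.inner_map_map (T⁻¹ x) y]
  congr 1
  exact (T.apply_symm_apply x).symm

theorem isometryEquiv_inv_apply_self (T : H ≃ₗᵢ[ℂ] H) (x : H) : T⁻¹ (T x) = x :=
  T.symm_apply_apply x

theorem isometryEquiv_apply_inv_self (T : H ≃ₗᵢ[ℂ] H) (x : H) : T (T⁻¹ x) = x :=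
  T.apply_symm_apply x

theorem isometryEquiv_mul_apply (S T : H ≃ₗᵢ[ℂ] H) (x : H) : (S * T) x = S (T x) := rfl

theorem inner_self_eq_ofReal_norm_sq (x : H) : inner ℂ x x = ((‖x‖ ^ 2 : ℝ) : ℂ) := by
  rw [inner_self_eq_norm_sq_to_K]
  norm_cast

variable [CompleteSpace H]

/-- The mean of a unitary representation of an abelian group kills the orthogonal complement of
the fixed vectors. -/
theorem IsInvariantMean.mean_inner_eq_zero {G : Type*} [AddCommGroup G] {m : (G → ℂ) → ℂ}
    (hm : IsInvariantMean m) {W : G → (H ≃ₗᵢ[ℂ] H)} (hW : ∀ a b, W (a + b) = W a * W b)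
    {ζ : H} (hζ : ∀ y, (∀ a, W a y = y) → inner ℂ y ζ = 0) (ζ' : H) :
    m (fun c => inner ℂ ζ' (W c ζ)) = 0 := by
  -- The mean `y` of `(W c)⁻¹ ζ'` is fixed by every `W a`, by invariance of `m`, hence orthogonal to
  -- `ζ`.
  obtain ⟨y, hy⟩ := hm.exists_vectorMean (F := fun c => (W c)⁻¹ ζ') (C := ‖ζ'‖)
    fun c => (LinearIsometryEquiv.norm_map _ _).le
  have hy' : ∀ w, inner ℂ y w = m (fun c => inner ℂ ζ' (W c w)) := fun w => by
    simp only [hy, inner_isometryEquiv_apply]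
  rw [← hy']
  refine hζ y fun a => ext_inner_right ℂ fun w => ?_
  have hb : IsBoundedFun fun c => inner ℂ ζ' (W c ((W a)⁻¹ w)) :=
    isBoundedFun_inner (fun _ => le_refl ‖ζ'‖) fun c => (LinearIsometryEquiv.norm_map _ _).le
  have h := hm.translate a hb
  have h2 : inner ℂ (W a y) w = inner ℂ y ((W a)⁻¹ w) := by
    rw [inner_isometryEquiv_apply, inv_inv]
  rw [h2, hy', hy', ← h]
  congr 1
  ext c
  rw [hW, isometryEquiv_mul_apply]
  rw [isometryEquiv_apply_inv_self]

variable {k : Type*} [Field k]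

/-- Averages along the squares of a field project onto the common fixed vectors of the squares:
in odd characteristic by van der Corput's trick, in characteristic two because squaring is
additive. -/
theorem IsInvariantMean.mean_inner_sq [Infinite k] {m : (k → ℂ) → ℂ} (hm : IsInvariantMean m)
    {V : k → (H ≃ₗᵢ[ℂ] H)} (hV : ∀ a b, V (a + b) = V a * V b)
    (K : Submodule ℂ H) [K.HasOrthogonalProjection] (hK : ∀ y, y ∈ K ↔ ∀ c, V (c ^ 2) y = y)
    (ζ ζ' : H) :
    m (fun c => inner ℂ ζ' (V (c ^ 2) ζ)) = inner ℂ ζ' (K.starProjection ζ) := by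
  have hVn : ∀ a ζ, ‖V a ζ‖ = ‖ζ‖ := fun a ζ => LinearIsometryEquiv.norm_map _ _
  have hb : ∀ (φ : k → k) (ζ ζ' : H), IsBoundedFun fun c => inner ℂ ζ' (V (φ c) ζ) := fun φ ζ ζ' =>
    isBoundedFun_inner (fun _ => le_refl ‖ζ'‖) fun c => (hVn _ _).le
  have hVinv : ∀ a, (V a)⁻¹ = V (-a) := by
    intro a
    have h0 : V 0 = 1 := by
      have := hV 0 0
      rw [add_zero] at this
      exact (mul_eq_left.1 this.symm)
    rw [inv_eq_iff_mul_eq_one, ← hV, add_neg_cancel, h0]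
  -- reduction to vectors orthogonal to `K`
  suffices hz : ∀ ζ, (∀ y ∈ K, inner ℂ y ζ = 0) → m (fun c => inner ℂ ζ' (V (c ^ 2) ζ)) = 0 by
    have h1 := hz (ζ - K.starProjection ζ) fun y hy =>
      (Submodule.mem_orthogonal K _).1 (K.sub_starProjection_mem_orthogonal ζ) y hy
    have h2 : ∀ c, V (c ^ 2) (K.starProjection ζ) = K.starProjection ζ :=
      (hK _).1 (K.starProjection_apply_mem ζ)
    simp only [map_sub, h2, inner_sub_right] at h1
    rw [hm.sub (hb _ _ _) (IsBoundedFun.const _), hm.const, sub_eq_zero] at h1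
    exact h1
  intro ζ hζ
  by_cases h2 : (2 : k) = 0
  · refine hm.mean_inner_eq_zero (W := fun c => V (c ^ 2)) (fun a b => ?_)
      (fun y hy => hζ y ((hK y).2 hy)) ζ'
    rw [← hV]
    congr 1
    linear_combination a * b * h2
  -- van der Corput's trick
  have hlin : ∀ (h e : k), h ≠ 0 → m (fun c => inner ℂ ζ (V (2 * h * c + e) ζ)) = 0 := by
    intro h e hh
    have h3 := hm.mean_inner_eq_zero (W := fun c => V (2 * h * c))
      (fun a b => by rw [mul_add, hV]) (ζ := ζ) (fun y hy => hζ y ((hK y).2 fun c => by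
        have := hy (c ^ 2 / (2 * h))
        rwa [mul_div_cancel₀ _ (mul_ne_zero h2 hh)] at this)) (V (-e) ζ)
    rw [← h3]
    congr 1
    ext c
    rw [add_comm, hV, isometryEquiv_mul_apply, inner_isometryEquiv_apply, hVinv]
  have hbound : ∀ N : ℕ, 0 < N →
      ‖m (fun c => inner ℂ ζ' (V (c ^ 2) ζ))‖ ^ 2 ≤ ‖ζ'‖ ^ 2 * ‖ζ‖ ^ 2 / N := by
    intro N hN
    have hN' : (N : ℂ) ≠ 0 := by exact_mod_cast hN.ne'
    obtain ⟨s, hs⟩ := Infinite.exists_subset_card_eq k N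
    -- Summing `N` shifts multiplies the mean by `N`, yet `‖w c‖ ^ 2` has mean only `N * ‖ζ‖ ^ 2`:
    -- the cross terms involve `(c + h) ^ 2 - (c + h') ^ 2`, affine in `c` with nonzero slope, and
    -- have mean zero by `hlin`.
    let w : k → H := fun c => ∑ h ∈ s, V ((c + h) ^ 2) ζ
    have hwn : ∀ c, ‖w c‖ ≤ N * ‖ζ‖ := fun c => by
      refine (norm_sum_le_of_le s fun h _ => (hVn _ _).le).trans ?_
      simp [hs]
    have hmw : m (fun c => inner ℂ ζ' (w c)) = N * m (fun c => inner ℂ ζ' (V (c ^ 2) ζ)) := by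
      simp only [w, inner_sum]
      rw [hm.sum s fun h _ => hb (fun c => (c + h) ^ 2) ζ ζ']
      rw [Finset.sum_congr rfl fun h _ => hm.translate h (hb (fun c => c ^ 2) ζ ζ'),
        Finset.sum_const, hs, nsmul_eq_mul]
    have hbw : IsBoundedFun fun c => inner ℂ ζ' (w c) :=
      isBoundedFun_inner (fun _ => le_refl ‖ζ'‖) hwn
    have hww : m (fun c => inner ℂ (w c) (w c)) = N * ‖ζ‖ ^ 2 := by
      have hexp : ∀ c, inner ℂ (w c) (w c) =
          ∑ h ∈ s, ∑ h' ∈ s, inner ℂ ζ (V (2 * (h - h') * c + (h ^ 2 - h' ^ 2)) ζ) := by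
        intro c
        simp only [w, inner_sum, sum_inner]
        refine Finset.sum_congr rfl fun h _ => Finset.sum_congr rfl fun h' _ => ?_
        have : (c + h) ^ 2 = (c + h') ^ 2 + (2 * (h - h') * c + (h ^ 2 - h' ^ 2)) := by ring
        rw [this, hV, isometryEquiv_mul_apply, LinearIsometryEquiv.inner_map_map]
      simp only [hexp]
      rw [hm.sum s fun h _ => IsBoundedFun.sum s fun h' _ => hb _ _ _]
      have hin : ∀ h ∈ s, m (fun c => ∑ h' ∈ s,
          inner ℂ ζ (V (2 * (h - h') * c + (h ^ 2 - h' ^ 2)) ζ)) = (‖ζ‖ ^ 2 : ℂ) := by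
        intro h hh
        rw [hm.sum s fun h' _ => hb _ _ _, Finset.sum_eq_single_of_mem h hh]
        · have h0 : V 0 ζ = ζ := by
            have := hV 0 0
            rw [add_zero] at this
            rw [mul_eq_left.1 this.symm]; rfl
          simp only [sub_self, mul_zero, zero_mul, add_zero, h0]
          rw [hm.const, inner_self_eq_ofReal_norm_sq, Complex.ofReal_pow]
        · intro h' _ hne
          exact hlin _ _ (sub_ne_zero.2 hne.symm)
      rw [Finset.sum_congr rfl hin, Finset.sum_const, hs, nsmul_eq_mul]
    have hcs := hm.norm_sq_le hbw
    have hle : m (fun c => ((‖inner ℂ ζ' (w c)‖ ^ 2 : ℝ) : ℂ)) ≤ (‖ζ'‖ ^ 2 : ℂ) * (N * ‖ζ‖ ^ 2) := by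
      rw [← hww, ← hm.const_mul _ (isBoundedFun_inner hwn hwn)]
      refine hm.mono ⟨(‖ζ'‖ * (N * ‖ζ‖)) ^ 2, fun c => ?_⟩
        ((isBoundedFun_inner hwn hwn).const_mul _) fun c => ?_
      · rw [Complex.norm_real, Real.norm_of_nonneg (sq_nonneg _)]
        gcongr
        exact (norm_inner_le_norm _ _).trans (mul_le_mul_of_nonneg_left (hwn c) (norm_nonneg _))
      · rw [inner_self_eq_ofReal_norm_sq]
        have : ‖inner ℂ ζ' (w c)‖ ^ 2 ≤ ‖ζ'‖ ^ 2 * ‖w c‖ ^ 2 := by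
          rw [← mul_pow]
          gcongr
          exact norm_inner_le_norm _ _
        have h3 := Complex.real_le_real.2 this
        push_cast at h3 ⊢
        exact h3
    have htot := hcs.trans hle
    rw [hmw, norm_mul, Complex.norm_natCast] at htot
    have htot' : ((N : ℝ) * ‖m (fun c => inner ℂ ζ' (V (c ^ 2) ζ))‖) ^ 2
        ≤ ‖ζ'‖ ^ 2 * (N * ‖ζ‖ ^ 2) := by exact_mod_cast htot
    have hNr : (0 : ℝ) < N := by exact_mod_cast hN
    rw [le_div_iff₀ hNr]
    refine le_of_mul_le_mul_left ?_ hNr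
    linarith [htot', mul_pow (N : ℝ) ‖m (fun c => inner ℂ ζ' (V (c ^ 2) ζ))‖ 2]
  have hlim : Tendsto (fun N : ℕ => ‖ζ'‖ ^ 2 * ‖ζ‖ ^ 2 / (N : ℝ)) atTop (𝓝 0) :=
    tendsto_const_div_atTop_nhds_zero_nat _
  have hfin : ‖m (fun c => inner ℂ ζ' (V (c ^ 2) ζ))‖ ^ 2 ≤ 0 :=
    ge_of_tendsto hlim (by filter_upwards [eventually_gt_atTop 0] with N hN using hbound N hN)
  have := pow_eq_zero_iff (two_ne_zero) |>.1 (le_antisymm hfin (sq_nonneg _))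
  exact norm_eq_zero.1 this

end SquareAverages

/-! ### Positive definite functions and the GNS construction -/

section PositiveDefinite

variable {Γ : Type*} [Group Γ] {φ : Γ → ℂ}

/-- The form on `1, g` is real for the coefficients `(1, 1)` and `(1, I)`; these give the imaginary
and the real part respectively. -/
theorem IsPositiveDefinite.map_inv (hφ : IsPositiveDefinite φ) (g : Γ) :
    φ g⁻¹ = star (φ g) := by
  have h0 := hφ 1 (fun _ => 1) (fun _ => 1)
  have h1 := hφ 2 ![1, 1] ![1, g]
  have h2 := hφ 2 ![1, Complex.I] ![1, g]
  simp only [Fin.sum_univ_two, Finset.univ_unique, Finset.sum_singleton, Matrix.cons_val_zero,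
    Matrix.cons_val_one, one_mul, inv_one, mul_one, inv_mul_cancel, Complex.nonneg_iff,
    Complex.add_re, Complex.add_im, Complex.mul_re, Complex.mul_im, Complex.star_def,
    Complex.conj_I, map_one, Complex.neg_re, Complex.neg_im, Complex.I_re, Complex.I_im] at h0 h1 h2
  rw [Complex.star_def]
  apply Complex.ext
  · rw [Complex.conj_re]
    linarith [h2.2, h0.2]
  · rw [Complex.conj_im]
    linarith [h1.2, h0.2]

theorem IsPositiveDefinite.sum_nonneg (hφ : IsPositiveDefinite φ) {ι : Type*} (s : Finset ι)
    (c : ι → ℂ) (g : ι → Γ) :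
    0 ≤ ∑ i ∈ s, ∑ j ∈ s, c i * star (c j) * φ ((g j)⁻¹ * g i) := by
  have h := hφ s.card (fun i => c (s.equivFin.symm i)) (fun i => g (s.equivFin.symm i))
  rw [← Finset.sum_coe_sort s]
  simp_rw [← Finset.sum_coe_sort s (fun j => _ * star (c j) * φ ((g j)⁻¹ * _))]
  rw [← s.equivFin.symm.sum_comp]
  simp_rw [← s.equivFin.symm.sum_comp (fun j => _ * star (c (j : ι)) * φ ((g (j : ι))⁻¹ * _))]
  exact h

end PositiveDefinite

/-- The GNS representation of a character: a Hilbert space with a total family of vectors indexed by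
the group, on which the group acts by left and by right translations. -/
structure GNSRep {Γ : Type*} [Group Γ] (τ : Γ → ℂ) (H : Type*) [NormedAddCommGroup H]
    [InnerProductSpace ℂ H] where
  vec : Γ → H
  left : Γ →* (H ≃ₗᵢ[ℂ] H)
  right : Γ →* (H ≃ₗᵢ[ℂ] H)
  inner_vec : ∀ g h, inner ℂ (vec h) (vec g) = τ (h⁻¹ * g)
  left_vec : ∀ g h, left g (vec h) = vec (g * h)
  right_vec : ∀ g h, right g (vec h) = vec (h * g⁻¹)
  dense : Dense (Submodule.span ℂ (Set.range vec) : Set H)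

section Construction

variable {Γ : Type*} {H : Type*} [NormedAddCommGroup H] [InnerProductSpace ℂ H]

theorem isometryEquiv_ext_of_dense {v : Γ → H}
    (hv : Dense (Submodule.span ℂ (Set.range v) : Set H)) {S T : H ≃ₗᵢ[ℂ] H}
    (h : ∀ g, S (v g) = T (v g)) : S = T := by
  have h1 : (S : H →L[ℂ] H) = (T : H →L[ℂ] H) := by
    refine ContinuousLinearMap.ext_on hv ?_
    rintro _ ⟨g, rfl⟩
    exact h g
  ext x
  exact congrArg (fun A : H →L[ℂ] H => A x) h1

theorem exists_isometryEquiv_of_perm [CompleteSpace H] {v : Γ → H}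
    (hv : Dense (Submodule.span ℂ (Set.range v) : Set H)) (σ : Equiv.Perm Γ)
    (hσ : ∀ g h, inner ℂ (v (σ h)) (v (σ g)) = inner ℂ (v h) (v g)) :
    ∃ T : H ≃ₗᵢ[ℂ] H, ∀ g, T (v g) = v (σ g) := by
  let e : (Γ →₀ ℂ) →ₗ[ℂ] H := Finsupp.linearCombination ℂ v
  have he : DenseRange e := by
    have : Set.range e = (Submodule.span ℂ (Set.range v) : Set H) := by
      rw [← Finsupp.range_linearCombination]; rfl
    rw [DenseRange, this]
    exact hv
  let S : (Γ →₀ ℂ) ≃ₗ[ℂ] (Γ →₀ ℂ) := Finsupp.domLCongr σ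
  have hn : ∀ f : Γ →₀ ℂ, ‖e (S f)‖ = ‖e f‖ := by
    intro f
    have h1 : e (S f) = f.sum fun g c => c • v (σ g) := by
      simp only [e, S, Finsupp.domLCongr_apply, Finsupp.domCongr_apply,
        Finsupp.linearCombination_apply, Finsupp.equivMapDomain_eq_mapDomain]
      rw [Finsupp.sum_mapDomain_index] <;> simp [add_smul]
    have h2 : inner ℂ (e (S f)) (e (S f))
        = inner ℂ (e f) (e f) := by
      rw [h1]
      simp only [e, Finsupp.linearCombination_apply, Finsupp.sum, inner_sum, sum_inner,
        inner_smul_left, inner_smul_right, hσ]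
    rw [inner_self_eq_ofReal_norm_sq, inner_self_eq_ofReal_norm_sq] at h2
    exact (sq_eq_sq₀ (norm_nonneg _) (norm_nonneg _)).1 (by exact_mod_cast h2)
  refine ⟨S.extendOfIsometry e e he he hn, fun g => ?_⟩
  have h := LinearEquiv.extendOfIsometry_eq S e e he he hn
    (Finsupp.single g 1)
  simpa [e, S] using h

universe u

/-- The Hilbert space of a positive definite function on a group. -/
theorem IsPositiveDefinite.exists_hilbertSpace {Γ : Type u} [Group Γ] {φ : Γ → ℂ}
    (hφ : IsPositiveDefinite φ) :
    ∃ (H : Type u) (_ : NormedAddCommGroup H) (_ : InnerProductSpace ℂ H) (_ : CompleteSpace H)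
      (v : Γ → H), (∀ g h, inner ℂ (v h) (v g) = φ (h⁻¹ * g)) ∧
        Dense (Submodule.span ℂ (Set.range v) : Set H) := by
  -- The form may be degenerate; the completion also divides out its null vectors.
  let core : PreInnerProductSpace.Core ℂ (Γ →₀ ℂ) :=
    { inner := fun f f' => f.sum fun h z => f'.sum fun g w => star z * w * φ (h⁻¹ * g)
      conj_inner_symm := fun f f' => by
        rw [Finsupp.sum_comm]
        simp only [map_finsuppSum]
        refine Finsupp.sum_congr fun h _ => Finsupp.sum_congr fun g _ => ?_
        have : φ (g⁻¹ * h) = star (φ (h⁻¹ * g)) := by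
          rw [← hφ.map_inv]; simp
        simp [this, mul_comm]
      add_left := fun _ _ _ => by
        rw [Finsupp.sum_add_index'] <;> simp [← Finsupp.sum_add, add_mul]
      smul_left := fun _ _ _ => by
        rw [Finsupp.sum_smul_index] <;> simp [Finsupp.mul_sum, ← mul_assoc]
      re_inner_nonneg := fun f => by
        have h := hφ.sum_nonneg f.support f id
        rw [Finset.sum_comm] at h
        have h' := (Complex.nonneg_iff.1 h).1
        simpa [Finsupp.sum, mul_comm] using h' }
  let _ : SeminormedAddCommGroup (Γ →₀ ℂ) :=
    InnerProductSpace.Core.toSeminormedAddCommGroup (𝕜 := ℂ)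
  let _ : InnerProductSpace ℂ (Γ →₀ ℂ) := InnerProductSpace.ofCore _
  refine ⟨UniformSpace.Completion (Γ →₀ ℂ), inferInstance, inferInstance, inferInstance,
    fun g => ((Finsupp.single g 1 : Γ →₀ ℂ) : UniformSpace.Completion (Γ →₀ ℂ)),
    fun g h => ?_, ?_⟩
  · rw [UniformSpace.Completion.inner_coe]
    change (Finsupp.single h (1 : ℂ)).sum (fun h z => (Finsupp.single g (1 : ℂ)).sum
      fun g w => star z * w * φ (h⁻¹ * g)) = _
    simp
  · refine UniformSpace.Completion.denseRange_coe.mono ?_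
    rintro _ ⟨f, rfl⟩
    induction f using Finsupp.induction_linear with
    | zero =>
      rw [UniformSpace.Completion.coe_zero]
      exact Submodule.zero_mem _
    | add f g hf hg =>
      rw [UniformSpace.Completion.coe_add]
      exact Submodule.add_mem _ hf hg
    | single g c =>
      have : (Finsupp.single g c : Γ →₀ ℂ) = c • Finsupp.single g 1 := by simp
      rw [this, UniformSpace.Completion.coe_smul]
      exact Submodule.smul_mem _ _ (Submodule.subset_span ⟨g, rfl⟩)

/-- Left translations preserve the Gram matrix of any positive definite function; right translations
do so because `τ` is a class function. -/
theorem IsGroupCharacter.exists_gnsRep {Γ : Type u} [Group Γ] {τ : Γ → ℂ}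
    (hτ : IsGroupCharacter τ) :
    ∃ (H : Type u) (_ : NormedAddCommGroup H) (_ : InnerProductSpace ℂ H) (_ : CompleteSpace H),
      Nonempty (GNSRep τ H) := by
  obtain ⟨H, _, _, _, v, hv, hd⟩ := hτ.1.exists_hilbertSpace
  choose L hL using fun a : Γ => exists_isometryEquiv_of_perm hd (Equiv.mulLeft a) fun g h => by
    rw [hv, hv]
    simp [mul_assoc]
  choose R hR using fun a : Γ => exists_isometryEquiv_of_perm hd (Equiv.mulRight a⁻¹) fun g h => by
    rw [hv, hv]
    simpa [mul_assoc] using hτ.2 (h⁻¹ * g) a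
  refine ⟨H, inferInstance, inferInstance, inferInstance, ⟨
    { vec := v
      left := MonoidHom.mk' L fun a b => isometryEquiv_ext_of_dense hd fun g => by
        rw [isometryEquiv_mul_apply]; simp [hL]
      right := MonoidHom.mk' R fun a b => isometryEquiv_ext_of_dense hd fun g => by
        rw [isometryEquiv_mul_apply]; simp [hR, mul_assoc]
      inner_vec := hv
      left_vec := fun g h => by simp [hL]
      right_vec := fun g h => by simp [hR]
      dense := hd }⟩⟩

end Construction

namespace GNSRep

variable {Γ : Type*} [Group Γ] {τ : Γ → ℂ} {H : Type*} [NormedAddCommGroup H]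
  [InnerProductSpace ℂ H] (π : GNSRep τ H)

theorem left_right_comm (g h : Γ) (x : H) :
    π.left g (π.right h x) = π.right h (π.left g x) := by
  have : π.left g * π.right h = π.right h * π.left g :=
    isometryEquiv_ext_of_dense π.dense fun a => by
      simp [isometryEquiv_mul_apply, left_vec, right_vec, mul_assoc]
  exact congrArg (fun T : H ≃ₗᵢ[ℂ] H => T x) this

/-- The conjugation representation on the GNS space. -/
def conj : Γ →* (H ≃ₗᵢ[ℂ] H) :=
  MonoidHom.mk' (fun g => π.left g * π.right g) fun g h => by
    ext x
    simp [isometryEquiv_mul_apply, π.left_right_comm]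

theorem conj_apply (g : Γ) (x : H) : π.conj g x = π.left g (π.right g x) := rfl

theorem conj_vec_one (g : Γ) : π.conj g (π.vec 1) = π.vec 1 := by
  simp [conj_apply, left_vec, right_vec]

theorem inner_left (g : Γ) (x y : H) :
    inner ℂ x (π.left g y) = inner ℂ (π.left g⁻¹ x) y := by
  rw [inner_isometryEquiv_apply, map_inv]

theorem inner_right (g : Γ) (x y : H) :
    inner ℂ x (π.right g y) = inner ℂ (π.right g⁻¹ x) y := by
  rw [inner_isometryEquiv_apply, map_inv]

theorem inner_conj (g : Γ) (x y : H) :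
    inner ℂ x (π.conj g y) = inner ℂ (π.conj g⁻¹ x) y := by
  rw [inner_isometryEquiv_apply, map_inv]

theorem inner_vec_one_left (g : Γ) : inner ℂ (π.vec 1) (π.left g (π.vec 1)) = τ g := by
  simp [left_vec, inner_vec]

theorem eq_of_inner_vec {x y : H} (h : ∀ g, inner ℂ (π.vec g) x = inner ℂ (π.vec g) y) :
    x = y := by
  refine Dense.eq_of_inner_right (𝕜 := ℂ) π.dense fun z => ?_
  have : ∀ z ∈ Submodule.span ℂ (Set.range π.vec), inner ℂ z x = inner ℂ z y := by
    intro z hz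
    induction hz using Submodule.span_induction with
    | mem z hz => obtain ⟨g, rfl⟩ := hz; exact h g
    | zero => simp
    | add a b _ _ ha hb => simp [ha, hb]
    | smul c a _ ha => simp [ha]
  exact this _

end GNSRep

/-- If `τ` vanishes on the quotients of an infinite family of conjugates of `g`, then
`τ g = 0`. -/
theorem IsGroupCharacter.eq_zero_of_conj_family {Γ : Type*} [Group Γ] {τ : Γ → ℂ}
    (hτ : IsGroupCharacter τ) {ι : Type*} [Infinite ι] (a : ι → Γ) (g : Γ)
    (ha : ∀ i, τ (a i) = τ g) (hort : Pairwise fun i j => τ ((a j)⁻¹ * a i) = 0) :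
    τ g = 0 := by
  classical
  by_contra hne
  obtain ⟨H, _, _, _, ⟨π⟩⟩ := hτ.exists_gnsRep
  have hpos : 0 < ‖τ g‖ := norm_pos_iff.2 hne
  have h1 : ∀ h, inner ℂ (π.vec h) (π.vec h) = τ 1 := fun h => by rw [π.inner_vec]; simp
  obtain ⟨N, hN⟩ := exists_nat_gt (‖τ 1‖ * ‖π.vec 1‖ ^ 2 / ‖τ g‖ ^ 2)
  obtain ⟨s, hs⟩ := Infinite.exists_subset_card_eq ι (N + 1)
  -- Orthogonality gives `‖w‖ ^ 2` growth linear in `N`, while the inner product of `w` with `π.vec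
  -- 1` is `(N + 1) * τ g`; Cauchy–Schwarz fails for large `N`.
  let w : H := ∑ i ∈ s, π.vec (a i)
  have hw : inner ℂ w w = (N + 1) * τ 1 := by
    simp only [w, sum_inner, inner_sum]
    rw [Finset.sum_congr rfl fun i hi => Finset.sum_eq_single_of_mem i hi fun j _ hji => by
      rw [π.inner_vec]; exact hort hji.symm]
    simp only [h1, Finset.sum_const, hs, nsmul_eq_mul]
    push_cast
    ring
  have hw1 : inner ℂ (π.vec 1) w = (N + 1) * τ g := by
    simp only [w, inner_sum, π.inner_vec, inv_one, one_mul, ha, Finset.sum_const, hs,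
      nsmul_eq_mul]
    push_cast
    ring
  have hN1 : (0 : ℝ) < N + 1 := by positivity
  have hnorm : ‖((N : ℂ) + 1)‖ = N + 1 := by
    have := Complex.norm_natCast (N + 1)
    push_cast at this
    exact this
  have hcs := norm_inner_le_norm (𝕜 := ℂ) (π.vec 1) w
  rw [hw1, norm_mul, hnorm] at hcs
  have hw2 : ‖w‖ ^ 2 = (N + 1) * ‖τ 1‖ := by
    have := congrArg norm hw
    rw [inner_self_eq_ofReal_norm_sq, Complex.norm_real, Real.norm_of_nonneg (sq_nonneg _),
      norm_mul, hnorm] at this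
    exact this
  have hsq : ((N + 1) * ‖τ g‖) ^ 2 ≤ ‖π.vec 1‖ ^ 2 * ((N + 1) * ‖τ 1‖) := by
    rw [← hw2, ← mul_pow]
    gcongr
  rw [div_lt_iff₀ (by positivity)] at hN
  have : (N + 1) * ‖τ g‖ ^ 2 ≤ ‖π.vec 1‖ ^ 2 * ‖τ 1‖ := by
    refine le_of_mul_le_mul_left ?_ hN1
    linarith
  nlinarith

/-! ### Matrix identities in `SL(2, k)` -/

namespace SL2

open Matrix

variable {k : Type*} [Field k]

/-- Upper unipotent matrices. -/
def upper (x : k) : SL(2, k) := ⟨!![1, x; 0, 1], by simp [det_fin_two]⟩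

/-- Lower unipotent matrices. -/
def lower (x : k) : SL(2, k) := ⟨!![1, 0; x, 1], by simp [det_fin_two]⟩

/-- Diagonal matrices. -/
def diag (a : kˣ) : SL(2, k) := ⟨!![(a : k), 0; 0, ((a⁻¹ : kˣ) : k)], by simp [det_fin_two]⟩

/-- Antidiagonal matrices. -/
def weyl (y : kˣ) : SL(2, k) := ⟨!![0, -((y⁻¹ : kˣ) : k); (y : k), 0], by simp [det_fin_two]⟩

theorem ext_entries {g h : SL(2, k)} (h00 : g 0 0 = h 0 0) (h01 : g 0 1 = h 0 1)
    (h10 : g 1 0 = h 1 0) (h11 : g 1 1 = h 1 1) : g = h := by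
  ext i j
  fin_cases i <;> fin_cases j <;> assumption

theorem det_eq (g : SL(2, k)) : g 0 0 * g 1 1 - g 0 1 * g 1 0 = 1 := by
  rw [← det_fin_two, g.det_coe]

theorem mul_entry (g h : SL(2, k)) (i j : Fin 2) :
    (g * h) i j = g i 0 * h 0 j + g i 1 * h 1 j := by
  simp [Matrix.mul_apply, Fin.sum_univ_two]

theorem inv_entries (g : SL(2, k)) :
    g⁻¹ 0 0 = g 1 1 ∧ g⁻¹ 0 1 = - g 0 1 ∧ g⁻¹ 1 0 = - g 1 0 ∧ g⁻¹ 1 1 = g 0 0 := by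
  simp [Matrix.SpecialLinearGroup.SL2_inv_expl]

section entries
variable (x : k) (a : kˣ)
@[simp] theorem upper_00 : upper x 0 0 = 1 := rfl
@[simp] theorem upper_01 : upper x 0 1 = x := rfl
@[simp] theorem upper_10 : upper x 1 0 = 0 := rfl
@[simp] theorem upper_11 : upper x 1 1 = 1 := rfl
@[simp] theorem lower_00 : lower x 0 0 = 1 := rfl
@[simp] theorem lower_01 : lower x 0 1 = 0 := rfl
@[simp] theorem lower_10 : lower x 1 0 = x := rfl
@[simp] theorem lower_11 : lower x 1 1 = 1 := rfl
@[simp] theorem diag_00 : diag a 0 0 = a := rfl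
@[simp] theorem diag_01 : diag a 0 1 = 0 := rfl
@[simp] theorem diag_10 : diag a 1 0 = 0 := rfl
@[simp] theorem diag_11 : diag a 1 1 = (a : k)⁻¹ := by simp [diag]
@[simp] theorem weyl_00 : weyl a 0 0 = 0 := rfl
@[simp] theorem weyl_01 : weyl a 0 1 = -(a : k)⁻¹ := by simp [weyl]
@[simp] theorem weyl_10 : weyl a 1 0 = a := rfl
@[simp] theorem weyl_11 : weyl a 1 1 = 0 := rfl
end entries

theorem upper_add (x y : k) : upper (x + y) = upper x * upper y := by
  apply ext_entries <;> simp [mul_entry, add_comm]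

theorem upper_zero : upper (0 : k) = 1 := by
  apply ext_entries <;> simp

theorem upper_inv (x : k) : (upper x)⁻¹ = upper (-x) := by
  rw [inv_eq_iff_mul_eq_one, ← upper_add, add_neg_cancel, upper_zero]

theorem diag_mul (a b : kˣ) : diag (a * b) = diag a * diag b := by
  apply ext_entries <;> simp [mul_entry, mul_comm]

theorem diag_one : diag (1 : kˣ) = 1 := by
  apply ext_entries <;> simp

theorem diag_inv (a : kˣ) : (diag a)⁻¹ = diag a⁻¹ := by
  rw [inv_eq_iff_mul_eq_one, ← diag_mul, mul_inv_cancel, diag_one]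

theorem diag_mul_upper (a : kˣ) (x : k) : diag a * upper x = upper ((a : k) ^ 2 * x) * diag a := by
  have := a.ne_zero
  apply ext_entries <;> simp [mul_entry]
  field_simp

theorem diag_conj_upper (a : kˣ) (x : k) :
    diag a * upper x * (diag a)⁻¹ = upper ((a : k) ^ 2 * x) := by
  rw [diag_mul_upper, mul_inv_cancel_right]

theorem weyl_inv_mul_diag (y a : kˣ) : (weyl y)⁻¹ * diag a = diag a⁻¹ * (weyl y)⁻¹ := by
  rw [inv_mul_eq_iff_eq_mul, ← mul_assoc, eq_mul_inv_iff_mul_eq]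
  apply ext_entries <;> simp [mul_entry, mul_comm]

theorem weyl_conj_upper (y : kˣ) (x : k) :
    weyl y * upper x * (weyl y)⁻¹ = lower (-(y : k) ^ 2 * x) := by
  have := y.ne_zero
  rw [mul_inv_eq_iff_eq_mul]
  apply ext_entries <;> simp [mul_entry]
  field_simp

/-- The relation behind the rank one Hecke algebra. -/
theorem weyl_conj_upper_sq (x c : kˣ) :
    weyl x⁻¹ * upper ((c : k) ^ 2 * x) * (weyl x⁻¹)⁻¹
      = upper (-((((c⁻¹ : kˣ) : k) ^ 2) * x)) * ((weyl x⁻¹)⁻¹ * (diag c * diag c))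
        * upper (-((((c⁻¹ : kˣ) : k) ^ 2) * x)) := by
  have hx := x.ne_zero
  have hc := c.ne_zero
  rw [weyl_conj_upper]
  obtain ⟨h1, h2, h3, h4⟩ := inv_entries (weyl x⁻¹)
  apply ext_entries <;> simp [mul_entry, h1, h2, h3, h4] <;> field_simp
  ring

/-- Bruhat decomposition of the big cell. The Weyl representative `weyl y` is arbitrary, since the
diagonal factor absorbs the choice. -/
theorem eq_upper_weyl_diag_upper (g : SL(2, k)) (y z : kˣ) (hz : g 1 0 = z) :
    g = upper (g 0 0 * (z : k)⁻¹) * weyl y * (diag (y⁻¹ * z) * upper (g 1 1 * (z : k)⁻¹)) := by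
  have hz' := z.ne_zero
  have hy := y.ne_zero
  have hd := det_eq g
  rw [hz] at hd
  apply ext_entries <;> simp [mul_entry, hz] <;> field_simp
  linear_combination -hd

theorem eq_diag_mul_upper (g : SL(2, k)) (h : g 1 0 = 0) :
    ∃ (a : kˣ) (x : k), (a : k) = g 0 0 ∧ g = diag a * upper x := by
  have hd := det_eq g
  rw [h, mul_zero, sub_zero] at hd
  refine ⟨⟨g 0 0, g 1 1, hd, by rw [mul_comm]; exact hd⟩, g 0 1 * g 1 1, rfl, ?_⟩
  apply ext_entries <;> simp [mul_entry, h]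
  · linear_combination (-g 0 1) * hd
  · exact eq_inv_of_mul_eq_one_right hd

end SL2

theorem finite_setOf_pow_eq {k : Type*} [Field k] {n : ℕ} (hn : 0 < n) (a : k) :
    {c : k | c ^ n = a}.Finite := by
  classical
  refine ((Polynomial.nthRoots n a).toFinset.finite_toSet).subset fun c hc => ?_
  simpa [Polynomial.mem_nthRoots hn] using hc

/-- Distinct fourth powers give both `c i ^ 2 ≠ c j ^ 2` and `(c j ^ 2 / c i ^ 2) ^ 2 ≠ 1`, the
conditions needed for the families of conjugates below. -/
theorem exists_units_pow_four_injective (k : Type*) [Field k] [Infinite k] :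
    ∃ c : ℕ → kˣ, Function.Injective fun i => (c i : k) ^ 4 := by
  have hinf : (Set.range fun a : kˣ => (a : k) ^ 4).Infinite := by
    intro hfin
    refine Set.infinite_univ (α := k) (((hfin.biUnion fun b _ =>
      finite_setOf_pow_eq (n := 4) (by norm_num) b).union (Set.finite_singleton 0)).subset
      fun x _ => ?_)
    by_cases hx : x = 0
    · right; simpa using hx
    · left
      simp only [Set.mem_iUnion]
      exact ⟨x ^ 4, ⟨Units.mk0 x hx, rfl⟩, rfl⟩
  have hι := hinf.to_subtype
  let e := Infinite.natEmbedding (Set.range fun a : kˣ => (a : k) ^ 4)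
  choose c hc using fun i => (e i).2
  refine ⟨c, fun i j hij => e.injective (Subtype.ext ?_)⟩
  rw [← hc i, ← hc j]
  exact hij

theorem IsConjInvariant.map_mul_comm {Γ : Type*} [Group Γ] {φ : Γ → ℂ} (h : IsConjInvariant φ)
    (a b : Γ) : φ (a * b) = φ (b * a) := by
  simpa [mul_assoc] using h (b * a) a

/-! ### Vanishing on unipotents implies vanishing off the centre -/

namespace SL2

variable {k : Type*} [Field k]

theorem diag_upper_inv_mul (a : kˣ) (x y : k) :
    (diag a * upper y)⁻¹ * (diag a * upper x) = upper (x - y) := by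
  rw [mul_inv_rev, mul_assoc, inv_mul_cancel_left, upper_inv, ← upper_add, neg_add_eq_sub]

section Vanishing

variable [Infinite k] {τ : SL(2, k) → ℂ}

/-- If `a ^ 2 = 1`, conjugating by diagonal matrices rescales `x` by distinct squares; otherwise
conjugating by `upper y` shifts it by `(a⁻¹ ^ 2 - 1) * y`. Either way the quotients are nontrivial
unipotents. -/
theorem map_diag_upper_eq_zero (hτ : IsGroupCharacter τ) (h : ∀ x, x ≠ 0 → τ (upper x) = 0)
    {a : kˣ} {x : k} (hax : (a : k) ^ 2 ≠ 1 ∨ x ≠ 0) : τ (diag a * upper x) = 0 := by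
  have ha := a.ne_zero
  by_cases ha2 : (a : k) ^ 2 = 1
  · have hx : x ≠ 0 := hax.resolve_left (not_not.2 ha2)
    obtain ⟨c, hc⟩ := exists_units_pow_four_injective k
    refine hτ.eq_zero_of_conj_family (fun i => diag a * upper ((c i : k) ^ 2 * x)) _
      (fun i => ?_) fun i j hij => ?_
    · rw [← hτ.2 (diag a * upper x) (diag (c i)), ← mul_assoc, ← diag_mul, mul_comm (c i),
        diag_mul, ← diag_conj_upper]
      simp only [mul_assoc]
    · dsimp only
      rw [diag_upper_inv_mul]
      refine h _ fun h0 => hij (hc ?_)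
      rw [← sub_mul, mul_eq_zero, or_iff_left hx, sub_eq_zero] at h0
      dsimp only
      linear_combination ((c i : k) ^ 2 + (c j : k) ^ 2) * h0
  · refine hτ.eq_zero_of_conj_family (ι := k)
      (fun y => diag a * upper (((a⁻¹ : kˣ) : k) ^ 2 * y + (x - y))) _
      (fun y => ?_) fun y z hyz => ?_
    · rw [← hτ.2 (diag a * upper x) (upper y)]
      congr 1
      rw [upper_add, ← mul_assoc, diag_mul_upper, upper_inv, sub_eq_add_neg, upper_add]
      have : (a : k) ^ 2 * (((a⁻¹ : kˣ) : k) ^ 2 * y) = y := by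
        simp only [Units.val_inv_eq_inv_val]
        field_simp
      rw [this]
      simp only [mul_assoc]
    · dsimp only
      rw [diag_upper_inv_mul]
      refine h _ fun h0 => ?_
      have h1 : (((a : k)⁻¹) ^ 2 - 1) * (y - z) = 0 := by
        simp only [Units.val_inv_eq_inv_val] at h0
        linear_combination h0
      rcases mul_eq_zero.1 h1 with h2 | h2
      · refine ha2 ?_
        field_simp at h2
        linear_combination -h2
      · exact hyz (sub_eq_zero.1 h2)

/-- A character of `SL₂` that vanishes on the unipotent elements vanishes off the centre. -/
theorem eq_zero_of_not_mem_center (hτ : IsGroupCharacter τ) (h : ∀ x, x ≠ 0 → τ (upper x) = 0)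
    {g : SL(2, k)} (hg : g ∉ Subgroup.center SL(2, k)) : τ g = 0 := by
  by_cases hc : g 1 0 = 0
  · obtain ⟨a, x, -, rfl⟩ := eq_diag_mul_upper g hc
    refine map_diag_upper_eq_zero hτ h ?_
    by_contra! hcon
    refine hg ((mem_center_SL2_iff _).2 ?_)
    obtain ⟨ha, rfl⟩ := hcon
    rw [upper_zero, mul_one]
    rcases sq_eq_one_iff.1 ha with h1 | h1
    · left
      apply ext_entries <;> simp [h1]
    · right
      apply ext_entries <;> simp [h1, inv_neg]
  · obtain ⟨c, hcinj⟩ := exists_units_pow_four_injective k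
    -- With this `y μ` the conjugate `f μ` has bottom row `μ ^ 2` times that of `g`. Proportional
    -- bottom rows make `f (c i) * (f (c j))⁻¹` upper triangular with first diagonal entry `c j ^ 2
    -- / c i ^ 2`, covered by the triangular case.
    let y : kˣ → k := fun μ => g 1 1 * (((μ : k)⁻¹) ^ 2 - 1) * (g 1 0)⁻¹
    let f : kˣ → SL(2, k) := fun μ =>
      upper (y μ) * ((diag μ)⁻¹ * g * diag μ) * (upper (y μ))⁻¹
    have hf10 : ∀ μ, f μ 1 0 = (μ : k) ^ 2 * g 1 0 := fun μ => by
      have := μ.ne_zero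
      simp only [f, upper_inv, diag_inv, mul_entry]
      simp
      ring
    have hf11 : ∀ μ, f μ 1 1 = (μ : k) ^ 2 * g 1 1 := fun μ => by
      have := μ.ne_zero
      simp only [f, upper_inv, diag_inv, mul_entry]
      simp [y]
      field_simp
      ring
    refine hτ.eq_zero_of_conj_family (fun i => f (c i)) g (fun i => ?_) fun i j hij => ?_
    · simp only [f]
      rw [hτ.2, hτ.2.map_mul_comm, mul_inv_cancel_left]
    · dsimp only
      rw [hτ.2.map_mul_comm]
      obtain ⟨h00, h01, h10, h11⟩ := inv_entries (f (c j))
      have hz : (f (c i) * (f (c j))⁻¹) 1 0 = 0 := by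
        rw [mul_entry, h00, h10, hf10, hf11, hf10, hf11]
        ring
      have hd := det_eq (f (c j))
      rw [hf10, hf11] at hd
      have ho : (f (c i) * (f (c j))⁻¹) 1 1 * (c j : k) ^ 2 = (c i : k) ^ 2 := by
        rw [mul_entry, h01, h11, hf10, hf11]
        linear_combination (c i : k) ^ 2 * hd
      obtain ⟨a, x, -, hax⟩ := eq_diag_mul_upper _ hz
      rw [hax] at ho ⊢
      refine map_diag_upper_eq_zero hτ h (Or.inl fun ha => hij (hcinj ?_))
      simp only [mul_entry, diag_10, diag_11, upper_01, upper_11, zero_mul, zero_add, mul_one]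
        at ho
      have ha0 := a.ne_zero
      have ho' : (c j : k) ^ 2 = a * (c i : k) ^ 2 := by
        rw [← ho]; field_simp
      dsimp only
      linear_combination (-((c j : k) ^ 2 + a * (c i : k) ^ 2)) * ho' - (c i : k) ^ 4 * ha

end Vanishing

/-! ### Normal subgroups containing unipotents -/

/-- A normal subgroup of `SL₂` over an infinite field that contains a nontrivial unipotent element
is the whole group. -/
theorem normal_eq_top [Infinite k] (N : Subgroup SL(2, k)) [hN : N.Normal] (x : kˣ)
    (hx : upper (x : k) ∈ N) : N = ⊤ := by
  have hu : ∀ c : kˣ, upper ((c : k) ^ 2 * x) ∈ N := fun c => by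
    rw [← diag_conj_upper]
    exact hN.conj_mem _ hx _
  have hd : ∀ c : kˣ, diag c * diag c ∈ N := by
    intro c
    -- By the rank one relation a conjugate of an element of `N` has this element as middle factor,
    -- between inverses of an element of `N`. Taking `c = 1` then isolates the Weyl element.
    have h1 : ∀ c : kˣ, (weyl x⁻¹)⁻¹ * (diag c * diag c) ∈ N := fun c => by
      have h2 := hN.conj_mem _ (hu c) (weyl x⁻¹)
      rw [weyl_conj_upper_sq, ← upper_inv] at h2
      have h3 := hu c⁻¹
      have h4 := N.mul_mem (N.mul_mem h3 h2) h3
      simpa [mul_assoc] using h4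
    have h5 := h1 1
    rw [diag_one, mul_one, mul_one] at h5
    exact (N.mul_mem_cancel_left h5).1 (h1 c)
  obtain ⟨c, hc⟩ := exists_units_pow_four_injective k
  obtain ⟨a, ha⟩ : ∃ a : kˣ, (a : k) ^ 4 ≠ 1 := by
    by_contra! hcon
    exact zero_ne_one (hc ((hcon (c 0)).trans (hcon (c 1)).symm))
  have hU : ∀ z, upper z ∈ N := by
    intro z
    -- The commutator of `diag a * diag a` with `upper s` is `upper ((a ^ 4 - 1) * s)`.
    have h1 := N.mul_mem (hd a) (hN.conj_mem _ (N.inv_mem (hd a))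
      (upper (z / ((a : k) ^ 4 - 1))))
    have h2 : diag a * diag a * (upper (z / ((a : k) ^ 4 - 1)) * (diag a * diag a)⁻¹
        * (upper (z / ((a : k) ^ 4 - 1)))⁻¹) = upper z := by
      have hne := sub_ne_zero.2 ha
      rw [upper_inv, ← diag_mul, ← mul_assoc, ← mul_assoc, diag_conj_upper, ← upper_add]
      congr 1
      push_cast
      field_simp
      ring
    rwa [h2] at h1
  have hL : ∀ z, lower z ∈ N := by
    intro z
    have h1 := hN.conj_mem _ (hU (-z)) (weyl 1)
    rw [weyl_conj_upper] at h1
    simpa using h1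
  have key : ∀ g : SL(2, k), g 1 0 ≠ 0 → g ∈ N := by
    intro g hg
    have hgd := det_eq g
    have : g = upper ((g 0 0 - 1) / g 1 0) * lower (g 1 0) * upper ((g 1 1 - 1) / g 1 0) := by
      apply ext_entries <;> simp [mul_entry] <;> field_simp
      · ring
      · linear_combination -hgd
      · ring
    rw [this]
    exact N.mul_mem (N.mul_mem (hU _) (hL _)) (hU _)
  refine (Subgroup.eq_top_iff' N).2 fun g => ?_
  by_cases hg : g 1 0 = 0
  · refine (N.mul_mem_cancel_left (hL 1)).1 (key _ ?_)
    have hgd := det_eq g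
    rw [hg, mul_zero, sub_zero] at hgd
    rw [mul_entry, hg]
    simpa using left_ne_zero_of_mul_eq_one hgd
  · exact key g hg

/-- A character taking the value `1` at a nontrivial unipotent element is trivial. -/
theorem eq_one_of_map_upper_eq_one [Infinite k] {τ : SL(2, k) → ℂ}
    (hτ : τ ∈ normalizedCharacters SL(2, k)) (x : kˣ) (hx : τ (upper (x : k)) = 1) :
    τ = fun _ => 1 := by
  obtain ⟨H, _, _, _, ⟨π⟩⟩ := hτ.1.exists_gnsRep
  -- The equality case of Cauchy–Schwarz exhibits `{τ = 1}` as a stabilizer, hence a subgroup.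
  have hmem : ∀ g, π.left g (π.vec 1) = π.vec 1 ↔ τ g = 1 := by
    intro g
    constructor
    · intro h
      rw [← π.inner_vec_one_left, h, π.inner_vec]
      simpa using hτ.2
    · intro h
      have h1 := hτ.1.1.map_inv g
      have h2 : inner ℂ (π.left g (π.vec 1) - π.vec 1) (π.left g (π.vec 1) - π.vec 1) = 0 := by
        rw [inner_sub_left, inner_sub_right, inner_sub_right]
        simp only [π.left_vec, π.inner_vec]
        simp [h, h1, hτ.2]
      exact sub_eq_zero.1 (inner_self_eq_zero.1 h2)
  let N : Subgroup SL(2, k) :=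
    { carrier := {g | τ g = 1}
      one_mem' := hτ.2
      mul_mem' := fun {a b} ha hb => (hmem _).1 (by
        rw [map_mul, isometryEquiv_mul_apply, (hmem b).2 hb, (hmem a).2 ha])
      inv_mem' := fun {a} ha => by
        change τ a⁻¹ = 1
        rw [hτ.1.1.map_inv, show τ a = 1 from ha, star_one] }
  have hN : N.Normal := ⟨fun g hg h => (hτ.1.2 g h).trans hg⟩
  have htop := normal_eq_top N x hx
  ext g
  exact (show g ∈ N from htop ▸ Subgroup.mem_top g)

end SL2

/-! ### Extremality and domination -/

/-- A character dominated by an extremal character is a multiple of it. -/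
theorem IsExtremalCharacter.eq_smul_of_dominated {Γ : Type*} [Group Γ] {τ φ : Γ → ℂ}
    (hτ : IsExtremalCharacter τ) (hφ : IsGroupCharacter φ)
    (hφ' : IsGroupCharacter fun g => τ g - φ g) {t : ℝ} (ht0 : 0 < t) (ht1 : t < 1)
    (ht : φ 1 = t) (g : Γ) : φ g = t * τ g := by
  have hsmul : ∀ (ψ : Γ → ℂ) (r : ℝ), 0 < r → IsGroupCharacter ψ → ψ 1 = r →
      (fun g => ((r⁻¹ : ℝ) : ℂ) * ψ g) ∈ normalizedCharacters Γ := by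
    intro ψ r hr hψ hψ1
    refine ⟨⟨fun n c g => ?_, fun a b => ?_⟩, ?_⟩
    · have h := mul_nonneg (Complex.zero_le_real.2 (inv_nonneg.2 hr.le)) (hψ.1 n c g)
      rw [Finset.mul_sum] at h
      simp_rw [Finset.mul_sum] at h
      refine h.trans_eq (Finset.sum_congr rfl fun i _ => Finset.sum_congr rfl fun j _ => ?_)
      ring
    · change _ * ψ _ = _ * ψ _
      rw [hψ.2]
    · change _ * ψ 1 = 1
      rw [hψ1, ← Complex.ofReal_mul, inv_mul_cancel₀ hr.ne', Complex.ofReal_one]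
  obtain ⟨hmem, hext⟩ := mem_extremePoints.1 hτ
  have h1 := hsmul φ t ht0 hφ ht
  have h2 := hsmul _ (1 - t) (sub_pos.2 ht1) hφ' (by rw [hmem.2, ht]; simp)
  have ht' : (t : ℂ) ≠ 0 := by exact_mod_cast ht0.ne'
  have ht1' : (1 - t : ℂ) ≠ 0 := by exact_mod_cast (sub_pos.2 ht1).ne'
  -- `τ` is the convex combination of `φ / t` and `(τ - φ) / (1 - t)` with weights `t` and `1 - t`.
  have h3 := (hext _ h1 _ h2 ⟨t, 1 - t, ht0, sub_pos.2 ht1, by ring, by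
    ext g
    simp only [Pi.add_apply, Pi.smul_apply, Complex.real_smul]
    push_cast
    field_simp
    ring⟩).1
  have h4 := congrFun h3 g
  simp only [Complex.ofReal_inv] at h4
  rw [← h4, mul_inv_cancel_left₀ ht']

theorem starProjection_isometryEquiv_comm {H : Type*} [NormedAddCommGroup H]
    [InnerProductSpace ℂ H] (K : Submodule ℂ H) [K.HasOrthogonalProjection] (T : H ≃ₗᵢ[ℂ] H)
    (h1 : ∀ y ∈ K, T y ∈ K) (h2 : ∀ y ∈ K, T⁻¹ y ∈ K) (z : H) :
    K.starProjection (T z) = T (K.starProjection z) := by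
  refine Submodule.eq_starProjection_of_mem_of_inner_eq_zero
    (h1 _ (K.starProjection_apply_mem z)) fun w hw => ?_
  rw [← map_sub, ← isometryEquiv_apply_inv_self T w, T.inner_map_map]
  exact K.starProjection_inner_eq_zero z _ (h2 w hw)

/-! ### The projection onto unipotent fixed vectors and its conjugates -/

namespace SL2

variable {k : Type*} [Field k] {τ : SL(2, k) → ℂ} {H : Type*} [NormedAddCommGroup H]
  [InnerProductSpace ℂ H] (π : GNSRep τ H) (x : kˣ)

/-- The vectors fixed by all the unipotent elements `upper (c ^ 2 * x)`. -/
def unipotentFixed : Submodule ℂ H where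
  carrier := {y | ∀ c : k, π.left (upper (c ^ 2 * x)) y = y}
  zero_mem' := fun c => map_zero _
  add_mem' := fun {a b} ha hb c => by rw [map_add, ha c, hb c]
  smul_mem' := fun r a ha c => by rw [map_smul, ha c]

theorem mem_unipotentFixed {y : H} :
    y ∈ unipotentFixed π x ↔ ∀ c : k, π.left (upper (c ^ 2 * x)) y = y := Iff.rfl

theorem left_upper_neg_of_mem {y : H} (hy : y ∈ unipotentFixed π x) (c : k) :
    π.left (upper (-(c ^ 2 * x))) y = y := by
  have h : π.left (upper (c ^ 2 * x))⁻¹ (π.left (upper (c ^ 2 * x)) y) = y := by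
    rw [map_inv, isometryEquiv_inv_apply_self]
  rwa [hy c, upper_inv] at h

instance [CompleteSpace H] : (unipotentFixed π x).HasOrthogonalProjection := by
  have hcl : IsClosed (unipotentFixed π x : Set H) := by
    have : (unipotentFixed π x : Set H) = ⋂ c : k, {y | π.left (upper (c ^ 2 * x)) y = y} := by
      ext y
      simp [mem_unipotentFixed]
    rw [this]
    exact isClosed_iInter fun c => isClosed_eq (LinearIsometryEquiv.continuous _) continuous_id
  have := hcl.completeSpace_coe
  infer_instance

theorem left_diag_mem {y : H} (hy : y ∈ unipotentFixed π x) (a : kˣ) :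
    π.left (diag a) y ∈ unipotentFixed π x := by
  intro c
  have h : upper (c ^ 2 * x) * diag a = diag a * upper ((c * (a : k)⁻¹) ^ 2 * x) := by
    have := a.ne_zero
    rw [diag_mul_upper]
    congr 2
    field_simp
  rw [← isometryEquiv_mul_apply, ← map_mul, h, map_mul, isometryEquiv_mul_apply, hy]

theorem left_upper_mem {y : H} (hy : y ∈ unipotentFixed π x) (z : k) :
    π.left (upper z) y ∈ unipotentFixed π x := by
  intro c
  rw [← isometryEquiv_mul_apply, ← map_mul, ← upper_add, add_comm, upper_add, map_mul,
    isometryEquiv_mul_apply, hy]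

theorem right_mem {y : H} (hy : y ∈ unipotentFixed π x) (g : SL(2, k)) :
    π.right g y ∈ unipotentFixed π x := by
  intro c
  rw [π.left_right_comm, hy]

variable [CompleteSpace H]

/-- The projection onto the vectors fixed by the unipotent elements `upper (c ^ 2 * x)`. -/
noncomputable def unipotentProj : H →L[ℂ] H := (unipotentFixed π x).starProjection

theorem unipotentProj_mem (y : H) : unipotentProj π x y ∈ unipotentFixed π x :=
  Submodule.starProjection_apply_mem _ y

theorem unipotentProj_eq_self {y : H} (hy : y ∈ unipotentFixed π x) : unipotentProj π x y = y :=
  Submodule.starProjection_eq_self_iff.2 hy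

theorem inner_unipotentProj (y z : H) :
    inner ℂ (unipotentProj π x y) z = inner ℂ y (unipotentProj π x z) :=
  Submodule.inner_starProjection_left_eq_right _ y z

theorem inner_unipotentProj_self (y : H) :
    inner ℂ (unipotentProj π x y) y = ((‖unipotentProj π x y‖ ^ 2 : ℝ) : ℂ) := by
  rw [← inner_self_eq_ofReal_norm_sq, inner_unipotentProj, inner_unipotentProj,
    unipotentProj_eq_self π x (unipotentProj_mem π x y)]

theorem norm_unipotentProj_le (y : H) : ‖unipotentProj π x y‖ ≤ ‖y‖ :=
  Submodule.norm_starProjection_apply_le _ y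

theorem unipotentProj_left_diag (a : kˣ) (y : H) :
    unipotentProj π x (π.left (diag a) y) = π.left (diag a) (unipotentProj π x y) :=
  starProjection_isometryEquiv_comm _ _ (fun _ hy => left_diag_mem π x hy a) (fun _ hy => by
    rw [← map_inv, diag_inv]; exact left_diag_mem π x hy _) y

theorem unipotentProj_left_upper (z : k) (y : H) :
    unipotentProj π x (π.left (upper z) y) = π.left (upper z) (unipotentProj π x y) :=
  starProjection_isometryEquiv_comm _ _ (fun _ hy => left_upper_mem π x hy z) (fun _ hy => by
    rw [← map_inv, upper_inv]; exact left_upper_mem π x hy _) y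

theorem unipotentProj_right (g : SL(2, k)) (y : H) :
    unipotentProj π x (π.right g y) = π.right g (unipotentProj π x y) :=
  starProjection_isometryEquiv_comm _ _ (fun _ hy => right_mem π x hy g) (fun _ hy => by
    rw [← map_inv]; exact right_mem π x hy _) y

/-- The conjugate by `g` of the projection onto the unipotent fixed vectors. -/
noncomputable def conjProj (g : SL(2, k)) (y : H) : H :=
  π.left g (unipotentProj π x (π.left g⁻¹ y))

theorem inner_conjProj (g : SL(2, k)) (y z : H) :
    inner ℂ (conjProj π x g y) z = inner ℂ y (conjProj π x g z) := by
  rw [conjProj, conjProj, π.inner_left, ← inner_unipotentProj, π.inner_left g⁻¹, inv_inv]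

theorem inner_conjProj_self (g : SL(2, k)) (y : H) :
    inner ℂ (conjProj π x g y) y = ((‖unipotentProj π x (π.left g⁻¹ y)‖ ^ 2 : ℝ) : ℂ) := by
  rw [inner_conjProj, conjProj, π.inner_left, ← inner_unipotentProj, inner_unipotentProj_self]

theorem norm_conjProj_le (g : SL(2, k)) (y : H) : ‖conjProj π x g y‖ ≤ ‖y‖ := by
  rw [conjProj, LinearIsometryEquiv.norm_map]
  refine (norm_unipotentProj_le π x _).trans ?_
  rw [LinearIsometryEquiv.norm_map]

/-- The image of the cyclic vector under `conjProj π x g`. -/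
noncomputable def orbitVec (g : SL(2, k)) : H := π.conj g (unipotentProj π x (π.vec 1))

/-- Right translations commute with `conjProj`, so the whole operator is encoded in the single
vector `orbitVec`. -/
theorem conjProj_vec (g h : SL(2, k)) :
    conjProj π x g (π.vec h) = π.right h⁻¹ (orbitVec π x g) := by
  have h1 : π.left g⁻¹ (π.vec h) = π.right h⁻¹ (π.right g (π.vec 1)) := by
    simp only [π.left_vec, π.right_vec, one_mul, inv_inv]
  rw [conjProj, h1, unipotentProj_right, unipotentProj_right, π.left_right_comm, orbitVec,
    π.conj_apply]

theorem conj_orbitVec (g h : SL(2, k)) :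
    π.conj g (orbitVec π x h) = orbitVec π x (g * h) := by
  rw [orbitVec, orbitVec, map_mul, isometryEquiv_mul_apply]

/-- The projection commutes with right translations and with left translation by `diag a`. Together
with `conj_upper_proj` this makes `orbitVec π x g` depend only on the coset of `g` modulo upper
triangular matrices. -/
theorem conj_diag_proj (a : kˣ) :
    π.conj (diag a) (unipotentProj π x (π.vec 1)) = unipotentProj π x (π.vec 1) := by
  rw [π.conj_apply, ← unipotentProj_right, ← unipotentProj_left_diag, ← π.conj_apply,
    π.conj_vec_one]

theorem conj_upper_proj (z : k) :
    π.conj (upper z) (unipotentProj π x (π.vec 1)) = unipotentProj π x (π.vec 1) := by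
  rw [π.conj_apply, ← unipotentProj_right, ← unipotentProj_left_upper, ← π.conj_apply,
    π.conj_vec_one]

theorem norm_orbitVec (g : SL(2, k)) : ‖orbitVec π x g‖ = ‖unipotentProj π x (π.vec 1)‖ :=
  LinearIsometryEquiv.norm_map _ _

theorem inner_orbitVec_vec_one (g : SL(2, k)) :
    inner ℂ (orbitVec π x g) (π.vec 1) = ((‖unipotentProj π x (π.vec 1)‖ ^ 2 : ℝ) : ℂ) := by
  rw [← inner_unipotentProj_self, ← π.conj_vec_one g, orbitVec,
    LinearIsometryEquiv.inner_map_map, π.conj_vec_one]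

/-- The common value of the inner products of distinct orbit vectors. -/
noncomputable def orbitInner : ℂ :=
  inner ℂ (unipotentProj π x (π.vec 1)) (orbitVec π x (weyl x⁻¹))

/-- In the Bruhat decomposition of `g` the outer triangular factors fix the projected cyclic vector
under conjugation, leaving only the Weyl element. -/
theorem inner_proj_orbitVec {g : SL(2, k)} (hg : g 1 0 ≠ 0) :
    inner ℂ (unipotentProj π x (π.vec 1)) (orbitVec π x g) = orbitInner π x := by
  rw [eq_upper_weyl_diag_upper g x⁻¹ (Units.mk0 _ hg) rfl]
  rw [orbitVec, map_mul, map_mul π.conj (diag _), isometryEquiv_mul_apply,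
    isometryEquiv_mul_apply, conj_upper_proj, conj_diag_proj, map_mul, isometryEquiv_mul_apply,
    π.inner_conj, upper_inv, conj_upper_proj]
  rfl

theorem inner_orbitVec {g h : SL(2, k)} (hgh : (g⁻¹ * h) 1 0 ≠ 0) :
    inner ℂ (orbitVec π x g) (orbitVec π x h) = orbitInner π x := by
  rw [← inner_proj_orbitVec π x hgh, ← conj_orbitVec, π.inner_conj, inv_inv]
  rfl

/-- `weyl x⁻¹` and its inverse both lie in the big cell, so swapping the two vectors does not change
the inner product. -/
theorem star_orbitInner : star (orbitInner π x) = orbitInner π x := by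
  have h1 : (1⁻¹ * weyl x⁻¹ : SL(2, k)) 1 0 ≠ 0 := by simp
  have h2 : ((weyl x⁻¹)⁻¹ * 1 : SL(2, k)) 1 0 ≠ 0 := by
    rw [mul_one, (inv_entries _).2.2.1]; simp
  rw [← inner_orbitVec π x h1]
  conv_rhs => rw [inner_orbitVec π x h1, ← inner_orbitVec π x h2]
  exact inner_conj_symm _ _

end SL2

/-! ### Averaging the conjugate projections -/

namespace SL2

variable {k : Type*} [Field k] {τ : SL(2, k) → ℂ} {H : Type*} [NormedAddCommGroup H]
  [InnerProductSpace ℂ H] [CompleteSpace H] (π : GNSRep τ H) (x : kˣ)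

theorem mean_left_sq [Infinite k] {m : (k → ℂ) → ℂ} (hm : IsInvariantMean m) (y z : H) :
    m (fun c => inner ℂ y (π.left (upper (c ^ 2 * x)) z)) = inner ℂ y (unipotentProj π x z) :=
  hm.mean_inner_sq (V := fun a => π.left (upper (a * x)))
    (fun a b => by rw [add_mul, upper_add, map_mul]) (unipotentFixed π x) (fun _ => Iff.rfl) z y

/-- `upper (c ^ 2 * x)` is conjugate to `upper x` for `c ≠ 0`, so the mean of `τ` along these
elements is `τ (upper x)`; that mean is also the matrix coefficient of the projection. -/
theorem map_upper_eq [Infinite k] (hτ : IsConjInvariant τ) :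
    τ (upper (x : k)) = ((‖unipotentProj π x (π.vec 1)‖ ^ 2 : ℝ) : ℂ) := by
  obtain ⟨m, hm⟩ := exists_invariantMean k
  have h := mean_left_sq π x hm (π.vec 1) (π.vec 1)
  rw [← inner_unipotentProj, inner_unipotentProj_self] at h
  rw [← h, ← hm.const (τ (upper (x : k)))]
  refine hm.congr_off_finite (IsBoundedFun.const _) (isBoundedFun_inner
    (fun _ => le_refl ‖π.vec 1‖) fun c => (LinearIsometryEquiv.norm_map _ _).le)
    ((Set.finite_singleton (0 : k)).subset fun c hc => ?_)
  by_contra hc0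
  refine hc ?_
  rw [π.inner_vec_one_left, ← hτ (upper (x : k)) (diag (Units.mk0 c hc0)), diag_conj_upper]
  rfl

/-- The condition is a nontrivial equation for `c ^ 2` or has no solution, so an invariant mean does
not see these `c`. -/
theorem finite_setOf_same_coset (g : SL(2, k)) :
    {c : k | ((upper (c ^ 2 * x) * weyl x⁻¹)⁻¹ * g) 1 0 = 0}.Finite := by
  have hx := x.ne_zero
  have hent : ∀ c : k, ((upper (c ^ 2 * x) * weyl x⁻¹)⁻¹ * g) 1 0
      = -(x : k)⁻¹ * (g 0 0 - c ^ 2 * x * g 1 0) := by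
    intro c
    obtain ⟨-, -, h3, h4⟩ := inv_entries (weyl x⁻¹)
    rw [mul_inv_rev, upper_inv]
    simp only [mul_entry, h3, h4]
    simp
    ring
  simp only [hent]
  by_cases hg : g 1 0 = 0
  · have hd := det_eq g
    rw [hg, mul_zero, sub_zero] at hd
    have h0 := left_ne_zero_of_mul_eq_one hd
    simp [hg, h0]
  · refine (finite_setOf_pow_eq two_pos (g 0 0 / (x * g 1 0))).subset fun c hc => ?_
    have h1 : -(x : k)⁻¹ ≠ 0 := neg_ne_zero.2 (inv_ne_zero hx)
    have h2 := (mul_eq_zero.1 hc).resolve_left h1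
    change c ^ 2 = _
    field_simp
    linear_combination -h2

section MeanVector

/-- `q` is the mean of the orbit vectors along the elements `upper (c ^ 2 * x) * weyl x⁻¹`. -/
def IsMeanVec (m : (k → ℂ) → ℂ) (q : H) : Prop :=
  ∀ w, inner ℂ q w = m (fun c => inner ℂ (orbitVec π x (upper (c ^ 2 * x) * weyl x⁻¹)) w)

variable {m : (k → ℂ) → ℂ} {q : H}

theorem mean_conjProj_vec (hq : IsMeanVec π x m q)
    (h : SL(2, k)) (w : H) :
    m (fun c => inner ℂ (conjProj π x (upper (c ^ 2 * x) * weyl x⁻¹) (π.vec h)) w)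
      = inner ℂ q (π.right h w) := by
  rw [hq]
  simp only [conjProj_vec, π.inner_right]

theorem isBoundedFun_conjProj (a : k → SL(2, k)) (y z : H) :
    IsBoundedFun fun c => inner ℂ (conjProj π x (a c) y) z :=
  isBoundedFun_inner (fun _ => norm_conjProj_le π x _ y) fun _ => le_refl ‖z‖

variable [Infinite k]

theorem inner_meanVec_orbitVec (hm : IsInvariantMean m) (hq : IsMeanVec π x m q) (g : SL(2, k)) :
    inner ℂ q (orbitVec π x g) = orbitInner π x := by
  rw [hq, ← hm.const (orbitInner π x)]
  refine hm.congr_off_finite (isBoundedFun_inner (fun c => (norm_orbitVec π x _).le)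
    fun _ => le_refl _) (IsBoundedFun.const _)
    ((finite_setOf_same_coset x g).subset fun c hc => ?_)
  by_contra hne
  exact hc (inner_orbitVec π x hne)

theorem inner_orbitVec_meanVec (hm : IsInvariantMean m) (hq : IsMeanVec π x m q) (g : SL(2, k)) :
    inner ℂ (orbitVec π x g) q = orbitInner π x := by
  rw [← inner_conj_symm, inner_meanVec_orbitVec π x hm hq]
  exact star_orbitInner π x

/-- `q` has inner product `orbitInner π x` with every orbit vector, hence with every translate
`π.conj g q`, in particular with itself. Expanding gives `‖π.conj g q - q‖ ^ 2 = 0`. -/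
theorem conj_meanVec (hm : IsInvariantMean m) (hq : IsMeanVec π x m q) (g : SL(2, k)) :
    π.conj g q = q := by
  have h1 : ∀ g, inner ℂ q (π.conj g q) = orbitInner π x := by
    intro g
    rw [hq]
    simp only [π.inner_conj, conj_orbitVec, inner_orbitVec_meanVec π x hm hq, hm.const]
  have h2 : inner ℂ q q = orbitInner π x := by simpa using h1 1
  have h3 : inner ℂ (π.conj g q) q = orbitInner π x := by
    rw [← inner_conj_symm, h1]
    exact star_orbitInner π x
  have h4 : inner ℂ (π.conj g q - q) (π.conj g q - q) = 0 := by
    rw [inner_sub_left, inner_sub_right, inner_sub_right, LinearIsometryEquiv.inner_map_map,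
      h1, h2, h3]
    ring
  exact sub_eq_zero.1 (inner_self_eq_zero.1 h4)

theorem inner_meanVec_vec_conj (hm : IsInvariantMean m) (hq : IsMeanVec π x m q)
    (h g : SL(2, k)) : inner ℂ q (π.vec (h * g * h⁻¹)) = inner ℂ q (π.vec g) := by
  have h1 : π.vec (h * g * h⁻¹) = π.conj h (π.vec g) := by
    rw [π.conj_apply, π.right_vec, π.left_vec, mul_assoc]
  rw [h1, π.inner_conj, conj_meanVec π x hm hq]

/-- The form attached to `q` is a mean of forms of orthogonal projections, so it lies between `0`
and the form of `τ`. Conjugation invariance of `q` exchanges `g i * (g j)⁻¹` for `(g j)⁻¹ * g i`. -/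
theorem mean_conjProj_sum (hm : IsInvariantMean m) (hq : IsMeanVec π x m q)
    {n : ℕ} (c : Fin n → ℂ) (g : Fin n → SL(2, k)) :
    m (fun a => inner ℂ (conjProj π x (upper (a ^ 2 * x) * weyl x⁻¹) (∑ i, c i • π.vec (g i)))
        (∑ i, c i • π.vec (g i)))
      = ∑ i, ∑ j, c i * star (c j) * inner ℂ q (π.vec ((g j)⁻¹ * g i)) := by
  have h1 : ∀ a, conjProj π x a (∑ i, c i • π.vec (g i))
      = ∑ i, c i • conjProj π x a (π.vec (g i)) := by
    intro a
    simp only [conjProj, map_sum, map_smul]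
  have hb : ∀ i j, IsBoundedFun fun a : k => inner ℂ
      (conjProj π x (upper (a ^ 2 * x) * weyl x⁻¹) (π.vec (g j))) (π.vec (g i)) :=
    fun i j => isBoundedFun_conjProj π x _ _ _
  have h2 : ∀ a, inner ℂ (conjProj π x a (∑ i, c i • π.vec (g i))) (∑ i, c i • π.vec (g i))
      = ∑ i, ∑ j, c i * star (c j) * inner ℂ (conjProj π x a (π.vec (g j))) (π.vec (g i)) := by
    intro a
    rw [h1, inner_sum]
    refine Finset.sum_congr rfl fun i _ => ?_
    rw [sum_inner]
    refine Finset.sum_congr rfl fun j _ => ?_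
    rw [inner_smul_left, inner_smul_right, Complex.star_def]
    ring
  simp only [h2]
  rw [hm.sum _ fun i _ => IsBoundedFun.sum _ fun j _ => (hb i j).const_mul _]
  refine Finset.sum_congr rfl fun i _ => ?_
  rw [hm.sum _ fun j _ => (hb i j).const_mul _]
  refine Finset.sum_congr rfl fun j _ => ?_
  rw [hm.const_mul _ (hb i j), mean_conjProj_vec π x hq, π.right_vec]
  rw [← inner_meanVec_vec_conj π x hm hq (g j) ((g j)⁻¹ * g i), mul_inv_cancel_left]

/-- The matrix coefficients of the mean vector form a character. -/
theorem isGroupCharacter_meanVec (hm : IsInvariantMean m) (hq : IsMeanVec π x m q) :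
    IsGroupCharacter fun g => inner ℂ q (π.vec g) := by
  refine ⟨fun n c g => ?_, fun g h => inner_meanVec_vec_conj π x hm hq h g⟩
  rw [← mean_conjProj_sum π x hm hq]
  refine hm.nonneg (isBoundedFun_conjProj π x _ _ _) fun a => ?_
  rw [inner_conjProj_self]
  exact Complex.zero_le_real.2 (sq_nonneg _)

theorem isGroupCharacter_sub_meanVec (hτ : IsGroupCharacter τ) (hm : IsInvariantMean m)
    (hq : IsMeanVec π x m q) : IsGroupCharacter fun g => τ g - inner ℂ q (π.vec g) := by
  refine ⟨fun n c g => ?_, fun g h => ?_⟩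
  · have h1 : ∑ i, ∑ j, c i * star (c j) * τ ((g j)⁻¹ * g i)
        = inner ℂ (∑ i, c i • π.vec (g i)) (∑ i, c i • π.vec (g i)) := by
      simp only [inner_sum, sum_inner, inner_smul_left, inner_smul_right, π.inner_vec,
        Complex.star_def]
      refine Finset.sum_congr rfl fun i _ => ?_
      rw [Finset.mul_sum]
      refine Finset.sum_congr rfl fun j _ => ?_
      ring
    simp only [mul_sub, Finset.sum_sub_distrib]
    rw [h1, ← mean_conjProj_sum π x hm hq, sub_nonneg, inner_self_eq_ofReal_norm_sq,
      ← hm.const ((_ : ℝ) : ℂ)]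
    refine hm.mono (isBoundedFun_conjProj π x _ _ _) (IsBoundedFun.const _) fun a => ?_
    rw [inner_conjProj_self]
    refine Complex.real_le_real.2 ?_
    gcongr
    exact (norm_unipotentProj_le π x _).trans (LinearIsometryEquiv.norm_map _ _).le
  · change τ _ - inner ℂ q (π.vec _) = _
    rw [hτ.2, inner_meanVec_vec_conj π x hm hq]

/-- For an extremal character the mean of the conjugates of the projection onto the unipotent fixed
vectors is a scalar. -/
theorem mean_conjProj (hτ : IsExtremalCharacter τ) (hm : IsInvariantMean m) {t : ℝ}
    (ht : ‖unipotentProj π x (π.vec 1)‖ ^ 2 = t) (ht0 : 0 < t) (ht1 : t < 1) (y z : H) :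
    m (fun c => inner ℂ (conjProj π x (upper (c ^ 2 * x) * weyl x⁻¹) y) z) = t * inner ℂ y z := by
  obtain ⟨q, hq⟩ := hm.exists_vectorMean
    (F := fun c => orbitVec π x (upper (c ^ 2 * x) * weyl x⁻¹)) fun c => (norm_orbitVec π x _).le
  have hq1 : inner ℂ q (π.vec 1) = t := by
    rw [hq]
    simp only [inner_orbitVec_vec_one, ht, hm.const]
  -- Extremality enters here: the character of `q` is dominated by `τ` and has value `t` at `1`.
  have hqt : q = (t : ℂ) • π.vec 1 := by
    refine π.eq_of_inner_vec fun g => ?_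
    have h1 := hτ.eq_smul_of_dominated (isGroupCharacter_meanVec π x hm hq)
      (isGroupCharacter_sub_meanVec π x hτ.1.1 hm hq) ht0 ht1 hq1 g
    rw [← inner_conj_symm, h1, ← inner_conj_symm (π.vec g), inner_smul_left, π.inner_vec]
    simp
  obtain ⟨w, hw⟩ := hm.exists_vectorMean
    (F := fun c => conjProj π x (upper (c ^ 2 * x) * weyl x⁻¹) y) fun c => norm_conjProj_le π x _ y
  rw [← hw]
  -- On the total family `π.vec g` the mean operator is a right translate of `q`, so `hqt`
  -- determines it.
  have hwy : w = (t : ℂ) • y := by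
    refine π.eq_of_inner_vec fun g => ?_
    rw [← inner_conj_symm, hw]
    have h2 := mean_conjProj_vec π x hq g y
    rw [hqt] at h2
    have h3 := hm.map_star (isBoundedFun_conjProj π x
      (fun c => upper (c ^ 2 * x) * weyl x⁻¹) (π.vec g) y)
    rw [h2] at h3
    have h4 : ∀ c : k, inner ℂ (conjProj π x (upper (c ^ 2 * x) * weyl x⁻¹) y) (π.vec g)
        = star (inner ℂ (conjProj π x (upper (c ^ 2 * x) * weyl x⁻¹) (π.vec g)) y) := fun c => by
      rw [inner_conjProj]
      exact (inner_conj_symm _ _).symm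
    simp only [h4]
    rw [h3, ← Complex.star_def, star_star, inner_smul_left, inner_smul_right, π.inner_right,
      π.right_vec]
    simp
  rw [hwy, inner_smul_left]
  simp

end MeanVector

/-- The elements `upper (c ^ 2 * x)` fix `y` and `z`, so the integrand in `mean_conjProj` is
constant in `c`. -/
theorem inner_conjProj_weyl [Infinite k] (hτ : IsExtremalCharacter τ) {t : ℝ}
    (ht : ‖unipotentProj π x (π.vec 1)‖ ^ 2 = t) (ht0 : 0 < t) (ht1 : t < 1) {y z : H}
    (hy : y ∈ unipotentFixed π x) (hz : z ∈ unipotentFixed π x) :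
    inner ℂ (conjProj π x (weyl x⁻¹) y) z = t * inner ℂ y z := by
  obtain ⟨m, hm⟩ := exists_invariantMean k
  rw [← mean_conjProj π x hτ hm ht ht0 ht1, ← hm.const (inner ℂ _ z)]
  congr 1
  ext c
  rw [conjProj, conjProj, mul_inv_rev, map_mul, map_mul, isometryEquiv_mul_apply,
    isometryEquiv_mul_apply, upper_inv, left_upper_neg_of_mem π x hy, ← inner_conj_symm,
    ← inner_conj_symm (π.left (upper _) _), π.inner_left (upper _), upper_inv,
    left_upper_neg_of_mem π x hz]

/-! ### The diagonal action on the fixed vectors and the dichotomy for `t` -/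

/-- The diagonal matrix with entry `c`, extended by `1` to `c = 0`. -/
noncomputable def diagOrOne (c : k) : SL(2, k) :=
  open Classical in if h : c = 0 then 1 else diag (Units.mk0 c h)

/-- For `c ≠ 0`, `weyl_conj_upper_sq` turns the integrand into a coefficient of `weyl x⁻¹ * upper (c
^ 2 * x) * (weyl x⁻¹)⁻¹`, its outer unipotent factors fixing `y` and `z`. The mean of the inner
factor is the projection, and `inner_conjProj_weyl` applies. -/
theorem mean_weyl_diag [Infinite k] {m : (k → ℂ) → ℂ} (hm : IsInvariantMean m)
    (hτ : IsExtremalCharacter τ) {t : ℝ}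
    (ht : ‖unipotentProj π x (π.vec 1)‖ ^ 2 = t) (ht0 : 0 < t) (ht1 : t < 1) {y z : H}
    (hy : y ∈ unipotentFixed π x) (hz : z ∈ unipotentFixed π x) :
    m (fun c => inner ℂ y (π.left ((weyl x⁻¹)⁻¹ * (diagOrOne c * diagOrOne c)) z))
      = t * inner ℂ y z := by
  rw [← inner_conjProj_weyl π x hτ ht ht0 ht1 hy hz, inner_conjProj, conjProj, π.inner_left,
    ← mean_left_sq π x hm]
  refine hm.congr_off_finite
    (isBoundedFun_inner (fun _ => le_refl ‖y‖) fun _ => (LinearIsometryEquiv.norm_map _ _).le)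
    (isBoundedFun_inner (fun _ => le_rfl) fun _ => (LinearIsometryEquiv.norm_map _ _).le)
    ((Set.finite_singleton (0 : k)).subset fun c hc => ?_)
  by_contra hc0
  refine hc ?_
  have hc0' : ¬ c = 0 := hc0
  have h1 := weyl_conj_upper_sq x (Units.mk0 c hc0')
  have h2 : inner ℂ (π.left (weyl x⁻¹)⁻¹ y)
      (π.left (upper (c ^ 2 * x)) (π.left (weyl x⁻¹)⁻¹ z))
      = inner ℂ y (π.left (weyl x⁻¹ * upper (c ^ 2 * x) * (weyl x⁻¹)⁻¹) z) := by
    rw [← π.inner_left]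
    simp only [map_mul, isometryEquiv_mul_apply]
  rw [h2]
  rw [Units.val_mk0] at h1
  rw [h1]
  simp only [diagOrOne, hc0', dite_false]
  rw [map_mul _ (_ * _) (upper _), isometryEquiv_mul_apply, left_upper_neg_of_mem π x hz,
    map_mul _ (upper _), isometryEquiv_mul_apply, π.inner_left (upper _), upper_inv, neg_neg, hy]

/-- `(weyl x⁻¹)⁻¹` inverts diagonal matrices, so in `mean_weyl_diag` a factor `diag b` applied to
`z` can be moved to `y`. Comparing the two values and cancelling `t ≠ 0` gives the claim weakly. -/
theorem left_diag_sq [Infinite k] (hτ : IsExtremalCharacter τ) {t : ℝ}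
    (ht : ‖unipotentProj π x (π.vec 1)‖ ^ 2 = t) (ht0 : 0 < t) (ht1 : t < 1) {y : H}
    (hy : y ∈ unipotentFixed π x) (b : kˣ) : π.left (diag b) (π.left (diag b) y) = y := by
  obtain ⟨m, hm⟩ := exists_invariantMean k
  have hb := left_diag_mem π x hy b
  have hbb := left_diag_mem π x hb b
  have key : ∀ z ∈ unipotentFixed π x,
      inner ℂ (π.left (diag b) (π.left (diag b) y)) z = inner ℂ y z := by
    intro z hz
    have h1 := mean_weyl_diag π x hm hτ ht ht0 ht1 hbb hz
    have h2 := mean_weyl_diag π x hm hτ ht ht0 ht1 hb (left_diag_mem π x hz b)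
    have h3 : ∀ c : k, inner ℂ (π.left (diag b) y)
          (π.left ((weyl x⁻¹)⁻¹ * (diagOrOne c * diagOrOne c)) (π.left (diag b) z))
        = inner ℂ (π.left (diag b) (π.left (diag b) y))
          (π.left ((weyl x⁻¹)⁻¹ * (diagOrOne c * diagOrOne c)) z) := by
      intro c
      have hcomm : diagOrOne c * diagOrOne c * diag b = diag b * (diagOrOne c * diagOrOne c) := by
        unfold diagOrOne
        split_ifs
        · simp
        · simp only [← diag_mul, mul_comm]
      have h4 : (weyl x⁻¹)⁻¹ * (diagOrOne c * diagOrOne c) * diag b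
          = (diag b)⁻¹ * ((weyl x⁻¹)⁻¹ * (diagOrOne c * diagOrOne c)) := by
        rw [mul_assoc, hcomm, ← mul_assoc, weyl_inv_mul_diag, mul_assoc, diag_inv]
      rw [← isometryEquiv_mul_apply (π.left (_ * _)), ← map_mul, h4, map_mul _ (diag b)⁻¹,
        isometryEquiv_mul_apply, π.inner_left (diag b)⁻¹, inv_inv]
    simp only [h3] at h2
    rw [h1, LinearIsometryEquiv.inner_map_map] at h2
    exact mul_left_cancel₀ (by exact_mod_cast ht0.ne') h2
  have h5 := key _ (Submodule.sub_mem _ hbb hy)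
  rw [← sub_eq_zero, ← inner_sub_left] at h5
  exact sub_eq_zero.1 (inner_self_eq_zero.1 h5)

/-- The cyclic vector of an extremal character is fixed by the unipotent elements or orthogonal to
all vectors they fix. -/
theorem norm_proj_sq_eq_zero_or_one [Infinite k] (hτ : IsExtremalCharacter τ) :
    ‖unipotentProj π x (π.vec 1)‖ ^ 2 = 0 ∨ ‖unipotentProj π x (π.vec 1)‖ ^ 2 = 1 := by
  by_contra! hcon
  obtain ⟨t, ht⟩ : ∃ t, ‖unipotentProj π x (π.vec 1)‖ ^ 2 = t := ⟨_, rfl⟩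
  have hvec : ‖π.vec 1‖ ^ 2 = 1 := by
    have h := inner_self_eq_ofReal_norm_sq (π.vec 1)
    rw [π.inner_vec, inv_mul_cancel, hτ.1.2] at h
    exact_mod_cast h.symm
  have hle : ‖unipotentProj π x (π.vec 1)‖ ^ 2 ≤ ‖π.vec 1‖ ^ 2 := by
    gcongr
    exact norm_unipotentProj_le π x _
  rw [hvec] at hle
  rw [ht] at hcon hle
  have ht0 : 0 < t := lt_of_le_of_ne (ht ▸ sq_nonneg _) hcon.1.symm
  have ht1 : t < 1 := lt_of_le_of_ne hle hcon.2
  obtain ⟨m, hm⟩ := exists_invariantMean k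
  -- Squares of diagonal matrices act trivially on fixed vectors, so the integrand in
  -- `mean_weyl_diag` is constant.
  have key : ∀ y ∈ unipotentFixed π x, ∀ z ∈ unipotentFixed π x,
      inner ℂ y (π.left (weyl x⁻¹)⁻¹ z) = t * inner ℂ y z := by
    intro y hy z hz
    rw [← mean_weyl_diag π x hm hτ ht ht0 ht1 hy hz, ← hm.const (inner ℂ y _)]
    congr 1
    ext c
    congr 1
    rw [map_mul, isometryEquiv_mul_apply, map_mul, isometryEquiv_mul_apply]
    congr 1
    unfold diagOrOne
    split_ifs with h
    · simp
    · exact (left_diag_sq π x hτ ht ht0 ht1 hz _).symm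
  set a := unipotentProj π x (π.vec 1) with ha
  have haK : a ∈ unipotentFixed π x := unipotentProj_mem π x _
  set b := π.left (weyl x⁻¹)⁻¹ a with hb
  have haa : inner ℂ a a = t := by rw [inner_self_eq_ofReal_norm_sq, ht]
  have hab : inner ℂ a b = t * t := by rw [key a haK a haK, haa]
  -- `‖unipotentProj π x b‖ ^ 2` is computed twice: `key` gives `t ^ 3`, `inner_conjProj_weyl` gives
  -- `t ^ 2`.
  have h1 := key _ (unipotentProj_mem π x b) a haK
  rw [← hb, inner_unipotentProj, inner_unipotentProj π x b a, unipotentProj_eq_self π x haK,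
    ← inner_conj_symm b a, hab] at h1
  have h2 := inner_conjProj_weyl π x hτ ht ht0 ht1 haK haK
  rw [inner_conjProj, conjProj, π.inner_left, ← hb, haa, h1] at h2
  simp only [map_mul, Complex.conj_ofReal] at h2
  have h3 : t * (t * t) = t * t := by exact_mod_cast h2
  have h4 : t * t * (t - 1) = 0 := by linear_combination h3
  have h5 : t * t * (t - 1) < 0 := mul_neg_of_pos_of_neg (by positivity) (by linarith)
  linarith

end SL2

theorem mainTheorem1 {k : Type*} [Field k] [Infinite k] (τ : SL(2, k) → ℂ)
    (hτ : IsExtremalCharacter τ) (hnt : τ ≠ fun _ => 1) :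
    IsInducedFrom τ (Subgroup.center SL(2, k)) := by
  intro g hg
  by_contra hgc
  refine hg (SL2.eq_zero_of_not_mem_center hτ.1.1 (fun x hx => ?_) hgc)
  obtain ⟨H, _, _, _, ⟨π⟩⟩ := hτ.1.1.exists_gnsRep
  have hmap := SL2.map_upper_eq π (Units.mk0 x hx) hτ.1.1.2
  rcases SL2.norm_proj_sq_eq_zero_or_one π (Units.mk0 x hx) hτ with h | h
  · rw [h] at hmap
    simpa using hmap
  · rw [h, Complex.ofReal_one] at hmap
    exact absurd (SL2.eq_one_of_map_upper_eq_one hτ.1 _ hmap) hnt
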